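/- Write $[a,b]$ for the determinant of a pair of vectors of $\mathbb{R}^2$. Let $\mathcal{P}$ be a normed plane whose unit circle is smooth, symmetric and quadratically convex, let $p(\theta)$, $\theta\in\mathbb{R}$, be the parameterization of its unit circle by the angle $\theta$ of its tangent with a fixed direction, so that $p(\theta+\pi)=-p(\theta)$, $[p,p']>0$ and $[p',p'']>0$, and let $q=p'/[p,p']$ be the dual parameterization. Endow the space $\mathcal{C}^0(S^1)$ of continuous $2\pi$-periodic functions $h:\mathbb{R}\to\mathbb{R}$ with the inner product $$\langle h_1,h_2\rangle=\int_0^{2\pi}h_1(\theta)h_2(\theta)\,[p,p'](\theta)\,d\theta$$ and its norm $\|\cdot\|_2$, and let $T$ be the operator with domain $\mathcal{C}^2(S^1)$ and $$Th=-\frac{1}{[p,p']}\left(\frac{h'}{[q,q']}\right)'.$$ Let $L_0=\{h\in\mathcal{C}^0(S^1):\int_0^{2\pi}h\,[p,p']\,d\theta=0\}$ be the space of functions of zero dual length. For an integer $k\ge1$ let $\Lambda_k$ be the set of all real $\lambda$ for which the equation $\frac{1}{[p,p']}\left(\frac{u'}{[q,q']}\right)'=-\lambda u$ has a nonzero solution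 $u:\mathbb{R}\to\mathbb{R}$ such that the vector $\left(u,\frac{u'}{[q,q']}\right)$ makes exactly $k/2$ clockwise turns around the origin while $\theta$ runs from $0$ to $\pi$. Put $\lambda_k^1=\min\Lambda_k$ and $\lambda_k^2=\max\Lambda_k$, and let $h_k^1,h_k^2$ be $2\pi$-periodic eigenfunctions, $Th_k^i=\lambda_k^ih_k^i$, with $\|h_k^i\|_2=1$, chosen orthogonal to each other if $\lambda_k^1=\lambda_k^2$. Then: 1. $T$ is self-adjoint with respect to $\langle\cdot,\cdot\rangle$: its domain is dense, $\langle h_1,Th_2\rangle=\langle Th_1,h_2\rangle$ for all $h_1,h_2\in\mathcal{C}^2(S^1)$, and if $g,f\in\mathcal{C}^0(S^1)$ satisfy $\langle g,Th\rangle=\langle f,h\rangle$ for all $h\in\mathcal{C}^2(S^1)$, then $g\in\mathcal{C}^2(S^1)$ and $Tg=f$. 2. $T$ restricts to a bijection from $\mathcal{C}^2(S^1)\cap L_0$ onto $L_0$, and its inverse $S:(L_0,\|\cdot\|_2)\to(L_0,\|\cdot\|_2)$ is a compact operator. 3. The minima and maxima $\lambda_k^1,\lambda_k^2$ and eigenfunctions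 $h_k^1,h_k^2$ as above exist for every $k\ge1$, and for every choice of them the functions $h_k^i$, $k\ge1$, $i=1,2$, together with the normalized constant function $h_0=1/\|1\|_2$, form an orthonormal basis of $\left(\mathcal{C}^0(S^1),\langle\cdot,\cdot\rangle\right)$: they are orthonormal, and every $h\in\mathcal{C}^0(S^1)$ satisfies $$h=\langle h_0,h\rangle h_0+\sum_{k\ge1}\sum_{i=1,2}\langle h_k^i,h\rangle h_k^i,$$ with unconditional convergence in $\|\cdot\|_2$. -/

import Mathlib

open scoped ContDiff InnerProductSpace

/-- The determinant `[a, b]` of a pair of vectors of the plane. -/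
def det2 (a b : ℝ × ℝ) : ℝ := a.1 * b.2 - a.2 * b.1

/-- A normed plane whose unit circle is smooth, symmetric and quadratically convex, together with
the parameterization `p` of the unit circle by the angle `θ` that the (positively oriented)
tangent makes with a fixed direction (the direction of angle `α`). -/
structure NormedPlane where
  /-- the norm -/
  N : Seminorm ℝ (ℝ × ℝ)
  definite : ∀ v, N v = 0 → v = 0
  /-- the parameterization of the unit circle -/
  p : ℝ → ℝ × ℝ
  smooth : ContDiff ℝ ∞ p
  range_p : Set.range p = {v | N v = 1}
  antipodal : ∀ θ, p (θ + Real.pi) = -p θ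
  tangent_angle : ∃ α : ℝ, ∀ θ, ∃ ρ : ℝ, 0 < ρ ∧
    deriv p θ = ρ • (Real.cos (θ + α), Real.sin (θ + α))
  quadratically_convex : ∀ θ, 0 < det2 (deriv p θ) (deriv (deriv p) θ)

namespace NormedPlane

noncomputable section

variable (P : NormedPlane)

/-- `[p, p']` -/
def pp (θ : ℝ) : ℝ := det2 (P.p θ) (deriv P.p θ)

/-- The dual parameterization `q = p' / [p, p']`. -/
def q (θ : ℝ) : ℝ × ℝ := (1 / P.pp θ) • deriv P.p θ

/-- `[q, q']` -/
def qq (θ : ℝ) : ℝ := det2 (P.q θ) (deriv P.q θ)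

/-- `u ↦ (1 / [p, p']) (u' / [q, q'])'` -/
def slOp (u : ℝ → ℝ) (θ : ℝ) : ℝ :=
  1 / P.pp θ * deriv (fun t => deriv u t / P.qq t) θ

theorem contDiff_deriv_p : ContDiff ℝ ∞ (deriv P.p) :=
  ((contDiff_infty_iff_deriv (f := P.p)).1 P.smooth).2

theorem contDiff_det2 {f g : ℝ → ℝ × ℝ} (hf : ContDiff ℝ ∞ f) (hg : ContDiff ℝ ∞ g) :
    ContDiff ℝ ∞ (fun θ => det2 (f θ) (g θ)) := by
  unfold det2
  exact (hf.fst.mul hg.snd).sub (hf.snd.mul hg.fst)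

theorem contDiff_pp : ContDiff ℝ ∞ P.pp :=
  contDiff_det2 P.smooth P.contDiff_deriv_p

theorem pp_pos (θ : ℝ) : 0 < P.pp θ := by
  obtain ⟨α, hα⟩ := P.tangent_angle
  have hp : Differentiable ℝ P.p := P.smooth.differentiable (by simp)
  set c := Real.cos (θ + α) with hc
  set d := Real.sin (θ + α) with hd
  have hder : ∀ s, HasDerivAt (fun s => det2 (P.p s) (c, d)) (det2 (deriv P.p s) (c, d)) s := by
    intro s
    have h1 := (hp s).hasDerivAt
    have h2 : HasDerivAt (fun s => (P.p s).1) (deriv P.p s).1 s := h1.fst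
    have h3 : HasDerivAt (fun s => (P.p s).2) (deriv P.p s).2 s := h1.snd
    exact (h2.mul_const d).sub (h3.mul_const c)
  have hanti : StrictAntiOn (fun s => det2 (P.p s) (c, d)) (Set.Icc θ (θ + Real.pi)) := by
    apply strictAntiOn_of_deriv_neg (convex_Icc _ _)
    · exact fun s _ => (hder s).continuousAt.continuousWithinAt
    · intro s hs
      rw [interior_Icc] at hs
      rw [(hder s).deriv]
      obtain ⟨ρ, hρ, he⟩ := hα s
      rw [he]
      have hsin : 0 < Real.sin (s - θ) :=
        Real.sin_pos_of_pos_of_lt_pi (by linarith [hs.1]) (by linarith [hs.2])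
      have hx : Real.sin (s - θ) =
          Real.sin (s + α) * c - Real.cos (s + α) * d := by
        rw [hc, hd, ← Real.sin_sub]; congr 1; ring
      have : det2 (ρ • (Real.cos (s + α), Real.sin (s + α))) (c, d) = -(ρ * Real.sin (s - θ)) := by
        rw [hx]; simp [det2]; ring
      rw [this]
      have := mul_pos hρ hsin
      linarith
  have hlt := hanti (Set.left_mem_Icc.2 (by linarith [Real.pi_pos]))
    (Set.right_mem_Icc.2 (by linarith [Real.pi_pos])) (by linarith [Real.pi_pos])
  simp only [P.antipodal θ] at hlt
  have hpos : 0 < det2 (P.p θ) (c, d) := by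
    have : det2 (-P.p θ) (c, d) = -det2 (P.p θ) (c, d) := by simp [det2]; ring
    linarith
  obtain ⟨ρ, hρ, he⟩ := hα θ
  have : P.pp θ = ρ * det2 (P.p θ) (c, d) := by
    rw [pp, he]; simp [det2]; ring
  rw [this]
  exact mul_pos hρ hpos

theorem contDiff_q : ContDiff ℝ ∞ P.q :=
  (contDiff_const.div P.contDiff_pp fun θ => (P.pp_pos θ).ne').smul P.contDiff_deriv_p

theorem contDiff_qq : ContDiff ℝ ∞ P.qq :=
  contDiff_det2 P.contDiff_q ((contDiff_infty_iff_deriv (f := P.q)).1 P.contDiff_q).2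

theorem qq_pos (θ : ℝ) : 0 < P.qq θ := by
  have h1 : HasDerivAt (fun t => 1 / P.pp t) (deriv (fun t => 1 / P.pp t) θ) θ :=
    ((contDiff_const.div P.contDiff_pp fun θ => (P.pp_pos θ).ne').differentiable
      (n := ∞) (by simp) θ).hasDerivAt
  have h2 : HasDerivAt (deriv P.p) (deriv (deriv P.p) θ) θ :=
    (P.contDiff_deriv_p.differentiable (by simp) θ).hasDerivAt
  have h3 : deriv P.q θ = _ := (h1.smul h2).deriv
  have h4 : P.qq θ = (1 / P.pp θ) ^ 2 * det2 (deriv P.p θ) (deriv (deriv P.p) θ) := by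
    rw [qq, h3]; simp [q, det2]; ring
  rw [h4]
  have := P.pp_pos θ
  have := P.quadratically_convex θ
  positivity

theorem periodic_deriv {E : Type*} [NormedAddCommGroup E] [NormedSpace ℝ E] {f : ℝ → E} {c : ℝ}
    (hf : Function.Periodic f c) : Function.Periodic (deriv f) c := by
  intro x
  rw [← deriv_comp_add_const f c x]
  congr 1
  exact funext hf

theorem periodic_p : Function.Periodic P.p (2 * Real.pi) := by
  intro θ
  rw [two_mul, ← add_assoc, P.antipodal, P.antipodal, neg_neg]

theorem periodic_pp : Function.Periodic P.pp (2 * Real.pi) := by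
  intro θ
  simp only [pp, P.periodic_p θ, periodic_deriv P.periodic_p θ]

theorem periodic_q : Function.Periodic P.q (2 * Real.pi) := by
  intro θ
  simp only [q, P.periodic_pp θ, periodic_deriv P.periodic_p θ]

theorem periodic_qq : Function.Periodic P.qq (2 * Real.pi) := by
  intro θ
  simp only [qq, P.periodic_q θ, periodic_deriv P.periodic_q θ]

/-- The continuous `2π`-periodic real functions, that is, the continuous functions on the circle. -/
def periodicFunctions : Submodule ℝ (ℝ → ℝ) where
  carrier := {h | Continuous h ∧ Function.Periodic h (2 * Real.pi)}
  add_mem' ha hb := ⟨ha.1.add hb.1, ha.2.add hb.2⟩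
  zero_mem' := ⟨continuous_const, fun _ => rfl⟩
  smul_mem' c _ h := ⟨h.1.const_smul c, fun θ => congrArg (c • ·) (h.2 θ)⟩

/-- The space `C⁰(S¹)`; it depends on the plane through its inner product, given below. -/
def C0 (_P : NormedPlane) : Type := periodicFunctions

instance : AddCommGroup P.C0 := inferInstanceAs (AddCommGroup periodicFunctions)

instance : Module ℝ P.C0 := inferInstanceAs (Module ℝ periodicFunctions)

instance : CoeFun P.C0 fun _ => ℝ → ℝ := ⟨fun h => h.1⟩

theorem C0.continuous {P : NormedPlane} (h : P.C0) : Continuous (h : ℝ → ℝ) := h.2.1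

theorem C0.periodic {P : NormedPlane} (h : P.C0) :
    Function.Periodic (h : ℝ → ℝ) (2 * Real.pi) := h.2.2

theorem C0.intervalIntegrable {P : NormedPlane} (f g : P.C0) :
    IntervalIntegrable (fun θ => f θ * g θ * P.pp θ) MeasureTheory.volume 0 (2 * Real.pi) :=
  ((f.continuous.mul g.continuous).mul P.contDiff_pp.continuous).intervalIntegrable _ _

/-- The inner product `⟨f, g⟩ = ∫₀^{2π} f(θ) g(θ) [p, p'](θ) dθ` on `C⁰(S¹)`. -/
abbrev innerCore : InnerProductSpace.Core ℝ P.C0 where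
  inner f g := ∫ θ in (0 : ℝ)..(2 * Real.pi), f θ * g θ * P.pp θ
  conj_inner_symm f g := by
    simp only [conj_trivial]
    congr 1
    funext θ
    ring
  re_inner_nonneg f := by
    simp only [RCLike.re_to_real]
    apply intervalIntegral.integral_nonneg (by positivity)
    intro θ _
    exact mul_nonneg (mul_self_nonneg _) (P.pp_pos θ).le
  add_left f g h := by
    rw [← intervalIntegral.integral_add (C0.intervalIntegrable f h) (C0.intervalIntegrable g h)]
    congr 1
    funext θ
    change (f θ + g θ) * h θ * P.pp θ = _
    ring
  smul_left f g r := by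
    simp only [conj_trivial]
    rw [← intervalIntegral.integral_const_mul]
    congr 1
    funext θ
    change (r * f θ) * g θ * P.pp θ = _
    ring
  definite f hf := by
    have h0 : ∀ x ∈ Set.Icc 0 (2 * Real.pi), f x = 0 := by
      by_contra! hne
      obtain ⟨x, hx, hfx⟩ := hne
      have : 0 < ∫ θ in (0 : ℝ)..(2 * Real.pi), f θ * f θ * P.pp θ := by
        apply intervalIntegral.integral_pos (by positivity)
        · exact ((f.continuous.mul f.continuous).mul P.contDiff_pp.continuous).continuousOn
        · intro θ _
          exact mul_nonneg (mul_self_nonneg _) (P.pp_pos θ).le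
        · exact ⟨x, hx, mul_pos (mul_self_pos.2 hfx) (P.pp_pos x)⟩
      exact this.ne' hf
    apply Subtype.ext
    funext x
    obtain ⟨y, hy, hxy⟩ := f.periodic.exists_mem_Ico₀ (by positivity) x
    change f x = 0
    rw [hxy]
    exact h0 y ⟨hy.1, hy.2.le⟩

instance : NormedAddCommGroup P.C0 := (innerCore P).toNormedAddCommGroup

instance : InnerProductSpace ℝ P.C0 := InnerProductSpace.ofCore (innerCore P).toCore

/-- The constant function `1`. -/
def one : P.C0 := ⟨fun _ => 1, continuous_const, fun _ => rfl⟩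

/-- `L₀`: the functions of zero dual length, `∫₀^{2π} h [p, p'] dθ = 0`. -/
def L0 : Submodule ℝ P.C0 where
  carrier := {h | ∫ θ in (0 : ℝ)..(2 * Real.pi), h θ * P.pp θ = 0}
  add_mem' {f g} hf hg := by
    have e : ∀ u : P.C0, IntervalIntegrable (fun θ => u θ * P.pp θ) MeasureTheory.volume
        0 (2 * Real.pi) := fun u =>
      (u.continuous.mul P.contDiff_pp.continuous).intervalIntegrable _ _
    have := intervalIntegral.integral_add (e f) (e g)
    rw [Set.mem_ofPred_eq] at hf hg ⊢
    rw [hf, hg, add_zero] at this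
    rw [← this]
    congr 1
    funext θ
    exact add_mul (f θ) (g θ) (P.pp θ)
  zero_mem' := by
    rw [Set.mem_ofPred_eq]
    have : ∀ θ, (0 : P.C0) θ * P.pp θ = 0 := fun θ => zero_mul (P.pp θ)
    simp [this]
  smul_mem' c f hf := by
    rw [Set.mem_ofPred_eq] at hf ⊢
    have := intervalIntegral.integral_const_mul (a := 0) (b := 2 * Real.pi)
      (μ := MeasureTheory.volume) c (fun θ => f θ * P.pp θ)
    rw [hf, mul_zero] at this
    rw [← this]
    congr 1
    funext θ
    exact mul_assoc c (f θ) (P.pp θ)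

theorem contDiff_flux {u : ℝ → ℝ} (hu : ContDiff ℝ 2 u) :
    ContDiff ℝ 1 (fun t => deriv u t / P.qq t) := by
  have h1 : ContDiff ℝ 1 (deriv u) := by
    have : ContDiff ℝ (1 + 1) u := by simpa [one_add_one_eq_two] using hu
    exact (contDiff_succ_iff_deriv.1 this).2.2
  exact h1.div (P.contDiff_qq.of_le (by exact_mod_cast le_top)) fun θ => (P.qq_pos θ).ne'

theorem slOp_mem {u : ℝ → ℝ} (hu : ContDiff ℝ 2 u) (hper : Function.Periodic u (2 * Real.pi)) :
    (fun θ => -P.slOp u θ) ∈ periodicFunctions := by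
  refine ⟨?_, ?_⟩
  · have h1 : Continuous (deriv fun t => deriv u t / P.qq t) :=
      (P.contDiff_flux hu).continuous_deriv le_rfl
    exact ((continuous_const.div P.contDiff_pp.continuous fun θ => (P.pp_pos θ).ne').mul h1).neg
  · have h1 : Function.Periodic (fun t => deriv u t / P.qq t) (2 * Real.pi) := by
      intro t
      simp only [P.periodic_qq t, periodic_deriv hper t]
    intro θ
    simp only [slOp, P.periodic_pp θ, periodic_deriv h1 θ]

/-- The operator `T h = -(1 / [p, p']) (h' / [q, q'])'` in `C⁰(S¹)`, with domain `C²(S¹)`. -/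
def T : P.C0 →ₗ.[ℝ] P.C0 where
  domain :=
    { carrier := {h | ContDiff ℝ 2 (h : ℝ → ℝ)}
      add_mem' := fun {a b} ha hb => by
        have ha' : ContDiff ℝ 2 (a : ℝ → ℝ) := ha
        have hb' : ContDiff ℝ 2 (b : ℝ → ℝ) := hb
        exact ha'.add hb'
      zero_mem' := by
        have : ContDiff ℝ 2 (fun _ : ℝ => (0 : ℝ)) := contDiff_const
        exact this
      smul_mem' := fun c a ha => by
        have ha' : ContDiff ℝ 2 (a : ℝ → ℝ) := ha
        exact ha'.const_smul c }
  toFun :=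
    { toFun := fun h => ⟨fun θ => -P.slOp h.1 θ, P.slOp_mem h.2 h.1.periodic⟩
      map_add' := by
        rintro ⟨f, hf⟩ ⟨g, hg⟩
        apply Subtype.ext
        funext θ
        change -P.slOp (fun t => f t + g t) θ = -P.slOp f θ + -P.slOp g θ
        have hf' : ContDiff ℝ 2 (f : ℝ → ℝ) := hf
        have hg' : ContDiff ℝ 2 (g : ℝ → ℝ) := hg
        have e : (fun t => deriv (fun t => f t + g t) t / P.qq t) =
            fun t => deriv f t / P.qq t + deriv g t / P.qq t := by
          funext t
          rw [deriv_fun_add (hf'.differentiable (by simp) t) (hg'.differentiable (by simp) t),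
            add_div]
        simp only [slOp, e]
        rw [deriv_fun_add ((P.contDiff_flux hf').differentiable (by simp) θ)
          ((P.contDiff_flux hg').differentiable (by simp) θ)]
        ring
      map_smul' := by
        rintro c ⟨f, hf⟩
        apply Subtype.ext
        funext θ
        change -P.slOp (fun t => c * f t) θ = c * -P.slOp f θ
        have hf' : ContDiff ℝ 2 (f : ℝ → ℝ) := hf
        have e : (fun t => deriv (fun t => c * f t) t / P.qq t) =
            fun t => c * (deriv f t / P.qq t) := by
          funext t
          rw [deriv_const_mul c (hf'.differentiable (by simp) t), mul_div_assoc]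
        simp only [slOp, e]
        rw [deriv_const_mul c ((P.contDiff_flux hf').differentiable (by simp) θ)]
        ring }

/-- `u` is a (not necessarily periodic) solution of `(1 / [p, p']) (u' / [q, q'])' = -λ u`. -/
def IsSolution (lam : ℝ) (u : ℝ → ℝ) : Prop :=
  ContDiff ℝ 2 u ∧ ∀ θ, P.slOp u θ = -lam * u θ

/-- The curve `(u, u' / [q, q'])` avoids the origin and makes `Δ` clockwise turns around it while
`θ` runs from `0` to `L`: `β` is a continuous polar angle of the curve and `r` its polar radius. -/
def HasIndex (u : ℝ → ℝ) (L Δ : ℝ) : Prop :=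
  ∃ r β : ℝ → ℝ, Continuous β ∧
    (∀ θ, 0 < r θ ∧ u θ = r θ * Real.cos (β θ) ∧ deriv u θ / P.qq θ = r θ * Real.sin (β θ)) ∧
    β 0 - β L = 2 * Real.pi * Δ

/-- The set of `λ` for which some nonzero solution has index `k / 2` on `[0, π]`. -/
def indexSet (k : ℕ+) : Set ℝ :=
  {lam | ∃ u, P.IsSolution lam u ∧ P.HasIndex u Real.pi (k / 2)}

/-- `lam k 0`, `lam k 1` are the eigenvalues `λ_k¹ ≤ λ_k²` and `h k 0`, `h k 1` are corresponding
normalized `2π`-periodic eigenfunctions `h_k¹`, `h_k²`; at a double eigenvalue `λ_k¹ = λ_k²` the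
two eigenfunctions are chosen orthogonal. -/
structure IsEigensystem (lam : ℕ+ → Fin 2 → ℝ) (h : ℕ+ → Fin 2 → P.C0) : Prop where
  isLeast : ∀ k, IsLeast (P.indexSet k) (lam k 0)
  isGreatest : ∀ k, IsGreatest (P.indexSet k) (lam k 1)
  eigen : ∀ k i, ∃ hd : h k i ∈ P.T.domain, P.T ⟨h k i, hd⟩ = lam k i • h k i
  norm_eq_one : ∀ k i, ‖h k i‖ = 1
  double : ∀ k, lam k 0 = lam k 1 → ⟪h k 0, h k 1⟫_ℝ = 0

/-- The functions `h_k^i` together with the normalized constant function. -/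
def basisFamily (h : ℕ+ → Fin 2 → P.C0) : Option (ℕ+ × Fin 2) → P.C0
  | none => ‖P.one‖⁻¹ • P.one
  | some (k, i) => h k i

end

end NormedPlane

open Filter Topology

/-! The equation is a Sturm–Liouville (Hill) equation whose coefficients are `π`-periodic, positive
and bounded. Its solutions are studied in Prüfer coordinates `u = r cos ψ`, `u' / [q, q'] = -r sin
ψ`, where `ψ' = [q, q'] sin² ψ + lam [p, p'] cos² ψ`. The sign makes clockwise turns increase `ψ`,
so `lam` lies in the `k`-th index set exactly when the phase, the growth of `ψ` on `[0, π]`, equals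
`k π` for some initial angle `a` (`mem_indexSet_iff`).

The phase is continuous in `(lam, a)`, strictly increasing in `lam`, below `π` for `lam ≤ 0`, and
tends to infinity with `lam` uniformly in `a`. Hence index sets are nonempty, compact and pairwise
disjoint. At the minimum of an index set `k π` is the largest phase over all `a`, at the maximum the
smallest. Conservation of the Wronskian gives `d phase / d a = 1 / r(π)² - 1` (`hasDerivAt_phase`),
so at such an extremum `r(π) = 1`: the solution is multiplied by `(-1)^k` over `[0, π]` and is
`2π`-periodic. Conversely, a positive periodic eigenvalue makes a vector of the solution plane an
eigenvector of the monodromy with eigenvalue `±1`. The phase then stays on one side of its value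
there, so the eigenvalue is an endpoint of an index set (`IsSolution.isLeast_or_isGreatest`). Thus
the chosen `h_k^i` span all eigenfunctions with positive eigenvalue.

For the functional analysis, two integrations solve `T u = f` on `L₀` with sup and Lipschitz bounds,
and Arzelà–Ascoli makes the Green operator compact; it is also symmetric. As `C⁰(S¹)` is not
complete, the spectral theorem is applied to the extension of this operator to the completion, whose
eigenvectors with nonzero eigenvalue already lie in `C⁰(S¹)`. A vector of the completion orthogonal
to the whole family is therefore orthogonal to the range of the Green operator and to the constants,
hence to the dense domain of `T`, and vanishes. -/

/-! ### Global solutions of an ordinary differential equation. -/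

theorem exists_hasDerivAt_of_lipschitz_of_bounded {f : ℝ → ℝ → ℝ} {K L : NNReal}
    (hlip : ∀ t, LipschitzWith K (f t)) (hcont : ∀ x, Continuous fun t => f t x)
    (hL : ∀ t x, ‖f t x‖ ≤ L) (a : ℝ) :
    ∃ ψ : ℝ → ℝ, ψ 0 = a ∧ ∀ t, HasDerivAt ψ (f t (ψ t)) t := by
  have key : ∀ N : ℕ, ∃ ψ : ℝ → ℝ, ψ 0 = a ∧
      ∀ t ∈ Set.Ioo (-(N : ℝ) - 1) (N + 1), HasDerivAt ψ (f t (ψ t)) t := by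
    intro N
    have h0 : (0 : ℝ) ∈ Set.Icc (-(N : ℝ) - 1) (N + 1) := by
      constructor <;> have : (0 : ℝ) ≤ N := N.cast_nonneg <;> linarith
    -- The speed is at most `L`, so a solution starting at `a` stays within `L * (N + 1)` of it on
    -- the whole interval, and no shrinking of the interval is needed.
    have hpl : IsPicardLindelof f (⟨0, h0⟩ : Set.Icc (-(N : ℝ) - 1) (N + 1)) a (L * (N + 1)) 0 L K :=
      { lipschitzOnWith := fun t _ => (hlip t).lipschitzOnWith
        continuousOn := fun x _ => (hcont x).continuousOn
        norm_le := fun t _ x _ => hL t x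
        mul_max_le := by
          have : max ((N : ℝ) + 1 - 0) (0 - (-(N : ℝ) - 1)) = N + 1 := by
            rw [sub_zero, zero_sub, neg_sub, sub_neg_eq_add, add_comm 1, max_self]
          simp only [this]
          simp }
    obtain ⟨ψ, h1, h2⟩ := hpl.exists_eq_forall_mem_Icc_hasDerivWithinAt₀
    exact ⟨ψ, h1, fun t ht => (h2 t (Set.Ioo_subset_Icc_self ht)).hasDerivAt
      (Icc_mem_nhds ht.1 ht.2)⟩
  choose ψ h0 hψ using key
  have agree : ∀ N M : ℕ, N ≤ M → ∀ t ∈ Set.Ioo (-(N : ℝ) - 1) (N + 1), ψ N t = ψ M t := by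
    intro N M hNM t ht
    have hNM' : (N : ℝ) ≤ M := by exact_mod_cast hNM
    have hz : (0 : ℝ) ∈ Set.Ioo (-(N : ℝ) - 1) (N + 1) := by
      constructor <;> have : (0 : ℝ) ≤ N := N.cast_nonneg <;> linarith
    refine ODE_solution_unique_of_mem_Ioo (v := f) (s := fun _ => Set.univ) (K := K)
      (fun t _ => (hlip t).lipschitzOnWith) hz
      (fun t ht => ⟨hψ N t ht, trivial⟩) (fun t ht => ⟨hψ M t ⟨?_, ?_⟩, trivial⟩)
      ((h0 N).trans (h0 M).symm) ht
    · linarith [ht.1]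
    · linarith [ht.2]
  have hmem : ∀ t : ℝ, t ∈ Set.Ioo (-(⌈|t|⌉₊ : ℝ) - 1) (⌈|t|⌉₊ + 1) := by
    intro t
    have h1 := Nat.le_ceil |t|
    have h2 := le_abs_self t
    have h3 := neg_abs_le t
    constructor <;> linarith
  -- The local solutions agree by uniqueness; at `t` the one with index `⌈|t|⌉₊` is defined on a
  -- neighbourhood.
  refine ⟨fun t => ψ ⌈|t|⌉₊ t, h0 _, fun t => ?_⟩
  have h := hψ ⌈|t|⌉₊ t (hmem t)
  refine h.congr_of_eventuallyEq ?_
  filter_upwards [Ioo_mem_nhds (hmem t).1 (hmem t).2] with r hr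
  rcases le_total ⌈|t|⌉₊ ⌈|r|⌉₊ with h | h
  · exact (agree _ _ h r hr).symm
  · exact agree _ _ h r (hmem r)

/-- The factor `sinc` keeps the difference quotient of `sin²` continuous on the diagonal. This
yields both the Lipschitz bound for the angle field and a linear equation for the difference of two
angles. -/
theorem sin_sq_sub_sin_sq (a b : ℝ) :
    Real.sin a ^ 2 - Real.sin b ^ 2 = Real.sin (a + b) * Real.sinc (a - b) * (a - b) := by
  have h1 : Real.sinc (a - b) * (a - b) = Real.sin (a - b) := by
    by_cases h : a - b = 0
    · simp [h]
    · rw [Real.sinc_of_ne_zero h, div_mul_cancel₀ _ h]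
  rw [mul_assoc, h1, Real.sin_add, Real.sin_sub]
  have ha := Real.sin_sq_add_cos_sq a
  have hb := Real.sin_sq_add_cos_sq b
  linear_combination Real.sin b ^ 2 * ha - Real.sin a ^ 2 * hb

/-! ### The Prüfer angle, its comparison theorems and the phase. -/

namespace NormedPlane

noncomputable section

variable (P : NormedPlane)

theorem deriv_add_const_of_antiperiodic {E : Type*} [NormedAddCommGroup E] [NormedSpace ℝ E]
    {f : ℝ → E} {c : ℝ} (hf : ∀ x, f (x + c) = -f x) (x : ℝ) :
    deriv f (x + c) = -deriv f x := by
  rw [← deriv_comp_add_const f c x]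
  have : (fun x => f (x + c)) = -f := funext hf
  rw [this, deriv.neg]

theorem pp_add_pi (θ : ℝ) : P.pp (θ + Real.pi) = P.pp θ := by
  simp only [pp, P.antipodal θ, deriv_add_const_of_antiperiodic P.antipodal θ, det2, Prod.fst_neg,
    Prod.snd_neg, neg_mul_neg]

theorem q_add_pi (θ : ℝ) : P.q (θ + Real.pi) = -P.q θ := by
  simp only [q, P.pp_add_pi, deriv_add_const_of_antiperiodic P.antipodal θ, smul_neg]

theorem qq_add_pi (θ : ℝ) : P.qq (θ + Real.pi) = P.qq θ := by
  simp only [qq, P.q_add_pi θ, deriv_add_const_of_antiperiodic P.q_add_pi θ, det2, Prod.fst_neg,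
    Prod.snd_neg, neg_mul_neg]

theorem exists_bounds_of_periodic {f : ℝ → ℝ} {c : ℝ} (hc : 0 < c) (hf : Continuous f)
    (hper : Function.Periodic f c) (hpos : ∀ x, 0 < f x) :
    ∃ m M : ℝ, 0 < m ∧ ∀ x, m ≤ f x ∧ f x ≤ M := by
  have hne : (Set.Icc 0 c).Nonempty := ⟨0, Set.left_mem_Icc.2 hc.le⟩
  obtain ⟨x, -, hx⟩ := isCompact_Icc.exists_isMinOn hne hf.continuousOn
  obtain ⟨y, -, hy⟩ := isCompact_Icc.exists_isMaxOn hne hf.continuousOn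
  refine ⟨f x, f y, hpos x, fun z => ?_⟩
  obtain ⟨t, ht, hzt⟩ := hper.exists_mem_Ico₀ hc z
  rw [hzt]
  exact ⟨hx ⟨ht.1, ht.2.le⟩, hy ⟨ht.1, ht.2.le⟩⟩

theorem exists_bounds : ∃ m M : ℝ, 0 < m ∧ 0 < M ∧
    ∀ θ, m ≤ P.pp θ ∧ P.pp θ ≤ M ∧ m ≤ P.qq θ ∧ P.qq θ ≤ M := by
  obtain ⟨m, M, hm, h⟩ := exists_bounds_of_periodic Real.pi_pos P.contDiff_pp.continuous
    P.pp_add_pi P.pp_pos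
  obtain ⟨m', M', hm', h'⟩ := exists_bounds_of_periodic Real.pi_pos P.contDiff_qq.continuous
    P.qq_add_pi P.qq_pos
  refine ⟨min m m', max M M', lt_min hm hm', lt_max_of_lt_left ((P.pp_pos 0).trans_le (h 0).2),
    fun θ => ⟨(min_le_left _ _).trans (h θ).1, (h θ).2.trans (le_max_left _ _),
      (min_le_right _ _).trans (h' θ).1, (h' θ).2.trans (le_max_right _ _)⟩⟩

/-- The vector field of the Prüfer angle. -/
def angleField (lam θ ψ : ℝ) : ℝ :=
  P.qq θ * Real.sin ψ ^ 2 + lam * P.pp θ * Real.cos ψ ^ 2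

theorem angleField_sub (lam lam' θ ψ ψ' : ℝ) :
    P.angleField lam' θ ψ' - P.angleField lam θ ψ =
      (P.qq θ - lam' * P.pp θ) * (Real.sin (ψ' + ψ) * Real.sinc (ψ' - ψ)) * (ψ' - ψ) +
        (lam' - lam) * P.pp θ * Real.cos ψ ^ 2 := by
  simp only [angleField, Real.cos_sq']
  linear_combination (P.qq θ - lam' * P.pp θ) * sin_sq_sub_sin_sq ψ' ψ

theorem exists_lipschitz_angleField (B : ℝ) :
    ∃ K : NNReal, ∀ lam, |lam| ≤ B → ∀ θ, LipschitzWith K (P.angleField lam θ) := by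
  obtain ⟨m, M, hm, hM, h⟩ := P.exists_bounds
  refine ⟨(M * (1 + |B|)).toNNReal, fun lam hlam θ => LipschitzWith.of_dist_le_mul fun ψ' ψ => ?_⟩
  rw [Real.coe_toNNReal _ (by positivity), Real.dist_eq, Real.dist_eq, angleField_sub, sub_self,
    zero_mul, zero_mul, add_zero, abs_mul]
  refine mul_le_mul_of_nonneg_right ?_ (abs_nonneg _)
  obtain ⟨h1, h2, h3, h4⟩ := h θ
  rw [abs_mul]
  have e1 : |P.qq θ - lam * P.pp θ| ≤ M * (1 + |B|) := by
    calc |P.qq θ - lam * P.pp θ| ≤ |P.qq θ| + |lam * P.pp θ| := abs_sub _ _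
      _ = P.qq θ + |lam| * P.pp θ := by
        rw [abs_mul, abs_of_pos (P.qq_pos θ), abs_of_pos (P.pp_pos θ)]
      _ ≤ M + |B| * M := add_le_add h4
        (mul_le_mul (hlam.trans (le_abs_self B)) h2 (P.pp_pos θ).le (abs_nonneg _))
      _ = _ := by ring
  have e2 : |Real.sin (ψ' + ψ) * Real.sinc (ψ' - ψ)| ≤ 1 := by
    rw [abs_mul]
    exact mul_le_one₀ (Real.abs_sin_le_one _) (abs_nonneg _) (Real.abs_sinc_le_one _)
  calc _ ≤ M * (1 + |B|) * 1 := mul_le_mul e1 e2 (abs_nonneg _) (by positivity)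
    _ = _ := mul_one _

theorem continuous_angleField (lam : ℝ) {ψ : ℝ → ℝ} (hψ : Continuous ψ) :
    Continuous fun θ => P.angleField lam θ (ψ θ) := by
  have h1 := P.contDiff_pp.continuous
  have h2 := P.contDiff_qq.continuous
  unfold angleField
  fun_prop

theorem exists_angle (lam a : ℝ) : ∃ ψ : ℝ → ℝ, ψ 0 = a ∧
    ∀ θ, HasDerivAt ψ (P.angleField lam θ (ψ θ)) θ := by
  obtain ⟨m, M, hm, hM, h⟩ := P.exists_bounds
  obtain ⟨K, hK⟩ := P.exists_lipschitz_angleField |lam|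
  refine exists_hasDerivAt_of_lipschitz_of_bounded (K := K) (L := (M * (1 + |lam|)).toNNReal)
    (hK lam le_rfl) (fun x => P.continuous_angleField lam continuous_const) (fun t x => ?_) a
  obtain ⟨h1, h2, h3, h4⟩ := h t
  rw [Real.coe_toNNReal _ (by positivity), Real.norm_eq_abs, angleField]
  have := P.pp_pos t
  have := P.qq_pos t
  calc |P.qq t * Real.sin x ^ 2 + lam * P.pp t * Real.cos x ^ 2|
      ≤ |P.qq t * Real.sin x ^ 2| + |lam * P.pp t * Real.cos x ^ 2| := abs_add_le _ _
    _ = P.qq t * Real.sin x ^ 2 + |lam| * P.pp t * Real.cos x ^ 2 := by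
      rw [abs_of_nonneg (by positivity), abs_mul, abs_mul, abs_of_pos (P.pp_pos t),
        abs_of_nonneg (sq_nonneg (Real.cos x))]
    _ ≤ M * 1 + |lam| * M * 1 := by
      gcongr
      · exact Real.sin_sq_le_one x
      · exact Real.cos_sq_le_one x
    _ = _ := by ring

/-- The Prüfer angle of the solution with initial angle `a`. -/
def angle (lam a : ℝ) : ℝ → ℝ := (P.exists_angle lam a).choose

theorem angle_zero (lam a : ℝ) : P.angle lam a 0 = a := (P.exists_angle lam a).choose_spec.1

theorem hasDerivAt_angle (lam a θ : ℝ) :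
    HasDerivAt (P.angle lam a) (P.angleField lam θ (P.angle lam a θ)) θ :=
  (P.exists_angle lam a).choose_spec.2 θ

theorem continuous_angle (lam a : ℝ) : Continuous (P.angle lam a) :=
  continuous_iff_continuousAt.2 fun θ => (P.hasDerivAt_angle lam a θ).continuousAt

theorem eq_angle {lam : ℝ} {ψ : ℝ → ℝ} (hψ : ∀ θ, HasDerivAt ψ (P.angleField lam θ (ψ θ)) θ) :
    ψ = P.angle lam (ψ 0) := by
  obtain ⟨K, hK⟩ := P.exists_lipschitz_angleField |lam|
  exact ODE_solution_unique_univ (v := P.angleField lam) (s := fun _ => Set.univ) (t₀ := 0)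
    (fun t => (hK lam le_rfl t).lipschitzOnWith) (fun t => ⟨hψ t, trivial⟩)
    (fun t => ⟨P.hasDerivAt_angle lam _ t, trivial⟩) (P.angle_zero _ _).symm

/-- The angle field is `π`-periodic in the angle: only squares of sine and cosine enter. Initial
angles may therefore be reduced modulo `π`. -/
theorem angle_add_int_mul_pi (lam a : ℝ) (n : ℤ) (θ : ℝ) :
    P.angle lam (a + n * Real.pi) θ = P.angle lam a θ + n * Real.pi := by
  have h := P.eq_angle (lam := lam) (ψ := fun θ => P.angle lam a θ + n * Real.pi) fun θ => by
    refine ((P.hasDerivAt_angle lam a θ).add_const (n * Real.pi)).congr_deriv ?_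
    simp only [angleField, Real.sin_add_int_mul_pi, Real.cos_add_int_mul_pi, mul_pow]
    have : ((-1 : ℝ) ^ n) ^ 2 = 1 := by
      rcases Int.even_or_odd n with hn | hn <;> simp [hn.neg_one_zpow]
    simp [this]
  rw [angle_zero] at h
  exact (congrFun h θ).symm

/-- Multiplied by a suitable integrating factor, the difference of two Prüfer angles has a
derivative of constant sign. -/
theorem exists_integrating_factor (lam lam' a a' : ℝ) : ∃ E : ℝ → ℝ, (∀ θ, 0 < E θ) ∧
    ∀ θ, HasDerivAt (fun θ => E θ * (P.angle lam' a' θ - P.angle lam a θ))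
      (E θ * ((lam' - lam) * P.pp θ * Real.cos (P.angle lam a θ) ^ 2)) θ := by
  set ψ := P.angle lam a
  set ψ' := P.angle lam' a'
  -- The difference `D = ψ' - ψ` satisfies `D' = g D + (lam' - lam) [p, p'] cos² ψ`, so `exp (-∫ g)`
  -- is the integrating factor.
  set g : ℝ → ℝ := fun θ => (P.qq θ - lam' * P.pp θ) *
    (Real.sin (ψ' θ + ψ θ) * Real.sinc (ψ' θ - ψ θ)) with hg
  have hgc : Continuous g := by
    have h1 := P.contDiff_pp.continuous
    have h2 := P.contDiff_qq.continuous
    have h3 := P.continuous_angle lam a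
    have h4 := P.continuous_angle lam' a'
    have h5 := Real.continuous_sinc
    fun_prop
  refine ⟨fun θ => Real.exp (-∫ t in (0 : ℝ)..θ, g t), fun θ => Real.exp_pos _, fun θ => ?_⟩
  have hE : HasDerivAt (fun θ => Real.exp (-∫ t in (0 : ℝ)..θ, g t))
      (Real.exp (-∫ t in (0 : ℝ)..θ, g t) * -g θ) θ :=
    (hgc.integral_hasStrictDerivAt 0 θ).hasDerivAt.neg.exp
  refine (hE.mul ((P.hasDerivAt_angle lam' a' θ).sub (P.hasDerivAt_angle lam a θ))).congr_deriv ?_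
  simp only [Pi.sub_apply]
  rw [angleField_sub, hg]
  ring

theorem angle_le_angle {lam lam' a a' : ℝ} (hl : lam ≤ lam') (ha : a ≤ a') {θ : ℝ} (hθ : 0 ≤ θ) :
    P.angle lam a θ ≤ P.angle lam' a' θ := by
  obtain ⟨E, hE, hd⟩ := P.exists_integrating_factor lam lam' a a'
  have hmono := monotone_of_hasDerivAt_nonneg hd fun θ =>
    mul_nonneg (hE θ).le (mul_nonneg (mul_nonneg (sub_nonneg.2 hl) (P.pp_pos θ).le) (sq_nonneg _))
  have h := hmono hθ
  simp only [angle_zero] at h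
  have h0 : 0 ≤ E 0 * (a' - a) := mul_nonneg (hE 0).le (sub_nonneg.2 ha)
  exact sub_nonneg.1 ((mul_nonneg_iff_of_pos_left (hE θ)).1 (h0.trans h))

theorem angle_lt_angle_of_lt_initial {lam a a' : ℝ} (ha : a < a') {θ : ℝ} (hθ : 0 ≤ θ) :
    P.angle lam a θ < P.angle lam a' θ := by
  obtain ⟨E, hE, hd⟩ := P.exists_integrating_factor lam lam a a'
  have hmono := monotone_of_hasDerivAt_nonneg hd fun θ => by simp
  have h := hmono hθ
  simp only [angle_zero] at h
  have h0 : 0 < E 0 * (a' - a) := mul_pos (hE 0) (sub_pos.2 ha)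
  exact sub_pos.1 ((mul_pos_iff_of_pos_left (hE θ)).1 (h0.trans_le h))

/-- Equality at `θ` would force the weighted difference, which is monotone and starts at `0`, to
vanish on `[0, θ]`. Then `cos ψ = 0` throughout, which is impossible because `ψ' = [q, q'] > 0`
wherever `cos ψ = 0`. -/
theorem angle_lt_angle_of_lt {lam lam' : ℝ} (hl : lam < lam') (a : ℝ) {θ : ℝ} (hθ : 0 < θ) :
    P.angle lam a θ < P.angle lam' a θ := by
  refine lt_of_le_of_ne (P.angle_le_angle hl.le le_rfl hθ.le) fun heq => ?_
  obtain ⟨E, hE, hd⟩ := P.exists_integrating_factor lam lam' a a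
  have hmono := monotone_of_hasDerivAt_nonneg hd fun θ =>
    mul_nonneg (hE θ).le (mul_nonneg (mul_nonneg (sub_nonneg.2 hl.le) (P.pp_pos θ).le)
      (sq_nonneg _))
  have hzero : ∀ t ∈ Set.Icc 0 θ, E t * (P.angle lam' a t - P.angle lam a t) = 0 := by
    intro t ht
    refine le_antisymm ((hmono ht.2).trans_eq (by simp [heq])) ?_
    exact (by simp [angle_zero] : (0 : ℝ) = _).trans_le (hmono ht.1)
  have hcos : ∀ t ∈ Set.Ioo 0 θ, Real.cos (P.angle lam a t) = 0 := by
    intro t ht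
    have h1 : HasDerivAt (fun θ => E θ * (P.angle lam' a θ - P.angle lam a θ)) 0 t := by
      refine (hasDerivAt_const t (0 : ℝ)).congr_of_eventuallyEq ?_
      filter_upwards [Ioo_mem_nhds ht.1 ht.2] with r hr
      exact hzero r (Set.Ioo_subset_Icc_self hr)
    have h2 := (hd t).unique h1
    have h3 : (lam' - lam) * P.pp t ≠ 0 := (mul_pos (sub_pos.2 hl) (P.pp_pos t)).ne'
    simpa [(hE t).ne', h3] using h2
  have hm : θ / 2 ∈ Set.Ioo 0 θ := ⟨by linarith, by linarith⟩
  have h1 : HasDerivAt (fun t => Real.cos (P.angle lam a t)) 0 (θ / 2) := by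
    refine (hasDerivAt_const _ (0 : ℝ)).congr_of_eventuallyEq ?_
    filter_upwards [Ioo_mem_nhds hm.1 hm.2] with r hr
    exact hcos r hr
  have h2 := (P.hasDerivAt_angle lam a (θ / 2)).cos.unique h1
  have hs : Real.sin (P.angle lam a (θ / 2)) ≠ 0 := by
    intro hs
    have := Real.sin_sq_add_cos_sq (P.angle lam a (θ / 2))
    rw [hs, hcos _ hm] at this
    norm_num at this
  have hq := (P.qq_pos (θ / 2)).ne'
  simp only [angleField, hcos _ hm] at h2
  simp [hs, hq] at h2

/-- The angle by which the Prüfer angle with initial value `a` grows on `[0, π]`. -/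
def phase (lam a : ℝ) : ℝ := P.angle lam a Real.pi - a

theorem phase_add_int_mul_pi (lam a : ℝ) (n : ℤ) :
    P.phase lam (a + n * Real.pi) = P.phase lam a := by
  simp only [phase, angle_add_int_mul_pi]
  ring

theorem phase_strictMono (a : ℝ) : StrictMono fun lam => P.phase lam a := fun _ _ h =>
  sub_lt_sub_right (P.angle_lt_angle_of_lt h a Real.pi_pos) a

theorem exists_mem_Ico_phase (a : ℝ) : ∃ b ∈ Set.Ico 0 Real.pi,
    (∃ n : ℤ, b = a + n * Real.pi) ∧ ∀ lam, P.phase lam a = P.phase lam b := by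
  obtain ⟨n, hn, -⟩ := existsUnique_add_zsmul_mem_Ico Real.pi_pos a 0
  rw [zsmul_eq_mul, zero_add] at hn
  exact ⟨_, hn, ⟨n, rfl⟩, fun lam => (P.phase_add_int_mul_pi lam a n).symm⟩

theorem angle_zero_int_mul_pi (n : ℤ) (θ : ℝ) : P.angle 0 (n * Real.pi) θ = n * Real.pi := by
  have h := P.eq_angle (lam := 0) (ψ := fun _ => n * Real.pi) fun θ => by
    refine (hasDerivAt_const θ _).congr_deriv ?_
    simp [angleField, Real.sin_int_mul_pi]
  exact (congrFun h θ).symm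

/-- For `lam = 0` the constants `n π` are solutions of the angle equation and act as barriers: an
angle starting in `[0, π)` stays below `π`. Smaller `lam` follow by monotonicity. -/
theorem phase_lt_pi {lam : ℝ} (hl : lam ≤ 0) (a : ℝ) : P.phase lam a < Real.pi := by
  refine ((P.phase_strictMono a).monotone hl).trans_lt ?_
  obtain ⟨b, hb, -, hab⟩ := P.exists_mem_Ico_phase a
  simp only [hab]
  have h1 := P.angle_lt_angle_of_lt_initial (lam := 0) hb.2 Real.pi_pos.le
  have h2 := P.angle_zero_int_mul_pi 1 Real.pi
  simp only [Int.cast_one, one_mul] at h2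
  have := hb.1
  rw [phase]
  linarith

theorem phase_pos {lam : ℝ} (hl : 0 < lam) (a : ℝ) : 0 < P.phase lam a := by
  have h : StrictMono (P.angle lam a) := by
    refine strictMono_of_hasDerivAt_pos (P.hasDerivAt_angle lam a) fun θ => ?_
    have h1 := P.pp_pos θ
    have h2 := P.qq_pos θ
    have h3 := Real.sin_sq_add_cos_sq (P.angle lam a θ)
    rw [angleField]
    by_cases hs : Real.sin (P.angle lam a θ) = 0
    · have : Real.cos (P.angle lam a θ) ^ 2 = 1 := by simpa [hs] using h3
      rw [hs, this]
      positivity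
    · positivity
  have := h Real.pi_pos
  rw [angle_zero] at this
  exact sub_pos.2 this

/-- Grönwall's inequality: the trajectory for a nearby parameter solves the equation for `lam` up to
an error at most `M` times the change of parameter. -/
theorem continuous_phase : Continuous fun x : ℝ × ℝ => P.phase x.1 x.2 := by
  obtain ⟨m, M, hm, hM, hb⟩ := P.exists_bounds
  suffices h : Continuous fun x : ℝ × ℝ => P.angle x.1 x.2 Real.pi from h.sub continuous_snd
  rw [continuous_iff_continuousAt]
  rintro ⟨lam, a⟩
  obtain ⟨K, hK⟩ := P.exists_lipschitz_angleField |lam|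
  have hle : ∀ x : ℝ × ℝ, dist (P.angle x.1 x.2 Real.pi) (P.angle lam a Real.pi) ≤
      gronwallBound (dist x.2 a) ((K + 1 : NNReal) : ℝ) (dist x.1 lam * M + 0) (Real.pi - 0) := by
    intro x
    -- The constant `K + 1` replaces `K` because the closed formula for `gronwallBound` used below
    -- needs a nonzero rate.
    refine dist_le_of_approx_trajectories_ODE (v := P.angleField lam) (a := 0) (b := Real.pi)
      (fun t => (hK lam le_rfl t).weaken (by simp))
      (P.continuous_angle _ _).continuousOn
      (fun t _ => (P.hasDerivAt_angle x.1 x.2 t).hasDerivWithinAt) (fun t _ => ?_)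
      (P.continuous_angle _ _).continuousOn
      (fun t _ => (P.hasDerivAt_angle lam a t).hasDerivWithinAt) (fun t _ => (dist_self _).le)
      (by simp [angle_zero]) Real.pi ⟨Real.pi_pos.le, le_rfl⟩
    rw [Real.dist_eq, angleField_sub, sub_self, mul_zero, zero_add, abs_mul, abs_mul,
      abs_of_pos (P.pp_pos t), abs_of_nonneg (sq_nonneg (Real.cos _)), ← Real.dist_eq]
    have h1 := (hb t).2.1
    have h2 := Real.cos_sq_le_one (P.angle x.1 x.2 t)
    have h3 := P.pp_pos t
    calc _ ≤ dist x.1 lam * M * 1 := by gcongr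
      _ = _ := mul_one _
  have hK1 : ((K + 1 : NNReal) : ℝ) ≠ 0 := by positivity
  simp only [gronwallBound_of_K_ne_0 hK1] at hle
  rw [ContinuousAt, tendsto_iff_dist_tendsto_zero]
  refine squeeze_zero (fun _ => dist_nonneg) hle ?_
  have hc : Continuous fun x : ℝ × ℝ => dist x.2 a * Real.exp ((K + 1 : NNReal) * (Real.pi - 0)) +
      (dist x.1 lam * M + 0) / (K + 1 : NNReal) *
        (Real.exp ((K + 1 : NNReal) * (Real.pi - 0)) - 1) := by fun_prop
  have := hc.tendsto (lam, a)
  simpa using this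

end

end NormedPlane

/-! ### Solutions as a plane with conserved Wronskian, and the derivative of the phase. -/

namespace NormedPlane

noncomputable section

variable (P : NormedPlane)

/-- The second component `u' / [q, q']` of the phase vector of `u`. -/
def flux (u : ℝ → ℝ) (θ : ℝ) : ℝ := deriv u θ / P.qq θ

variable {P}

theorem hasDerivAt_of_contDiff_two {u : ℝ → ℝ} (hu : ContDiff ℝ 2 u) (θ : ℝ) :
    HasDerivAt u (P.qq θ * P.flux u θ) θ := by
  rw [flux, mul_div_cancel₀ _ (P.qq_pos θ).ne']
  exact (hu.differentiable (by simp) θ).hasDerivAt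

theorem hasDerivAt_flux_of_contDiff_two {u : ℝ → ℝ} (hu : ContDiff ℝ 2 u) (θ : ℝ) :
    HasDerivAt (P.flux u) (P.pp θ * P.slOp u θ) θ := by
  have h := ((P.contDiff_flux hu).differentiable (by simp) θ).hasDerivAt
  rw [slOp, ← mul_assoc, mul_one_div_cancel (P.pp_pos θ).ne', one_mul]
  exact h

theorem IsSolution.hasDerivAt {lam : ℝ} {u : ℝ → ℝ} (hu : P.IsSolution lam u) (θ : ℝ) :
    HasDerivAt u (P.qq θ * P.flux u θ) θ :=
  hasDerivAt_of_contDiff_two hu.1 θ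

theorem IsSolution.hasDerivAt_flux {lam : ℝ} {u : ℝ → ℝ} (hu : P.IsSolution lam u) (θ : ℝ) :
    HasDerivAt (P.flux u) (-(lam * P.pp θ * u θ)) θ :=
  (hasDerivAt_flux_of_contDiff_two hu.1 θ).congr_deriv (by rw [hu.2]; ring)

theorem flux_eq_of_hasDerivAt {x y : ℝ → ℝ} (hx : ∀ θ, HasDerivAt x (P.qq θ * y θ) θ) :
    P.flux x = y := by
  funext θ
  rw [flux, (hx θ).deriv, mul_div_cancel_left₀ _ (P.qq_pos θ).ne']

theorem contDiff_two_of_hasDerivAt {x y z : ℝ → ℝ} (hx : ∀ θ, HasDerivAt x (P.qq θ * y θ) θ)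
    (hy : ∀ θ, HasDerivAt y (z θ) θ) (hz : Continuous z) : ContDiff ℝ 2 x := by
  have hy1 : ContDiff ℝ 1 y := by
    rw [contDiff_one_iff_deriv]
    refine ⟨fun θ => (hy θ).differentiableAt, ?_⟩
    rwa [show deriv y = z from funext fun θ => (hy θ).deriv]
  have : ContDiff ℝ (1 + 1) x := by
    refine contDiff_succ_iff_deriv.2 ⟨fun θ => (hx θ).differentiableAt, by simp, ?_⟩
    rw [show deriv x = fun θ => P.qq θ * y θ from funext fun θ => (hx θ).deriv]
    exact (P.contDiff_qq.of_le (by exact_mod_cast le_top)).mul hy1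
  simpa [one_add_one_eq_two] using this

theorem slOp_eq_of_hasDerivAt {x y z : ℝ → ℝ} (hx : ∀ θ, HasDerivAt x (P.qq θ * y θ) θ)
    (hy : ∀ θ, HasDerivAt y (z θ) θ) (θ : ℝ) : P.slOp x θ = z θ / P.pp θ := by
  have h := flux_eq_of_hasDerivAt hx
  have : (fun t => deriv x t / P.qq t) = y := h
  rw [slOp, this, (hy θ).deriv, one_div_mul_eq_div]

theorem isSolution_of_hasDerivAt {lam : ℝ} {x y : ℝ → ℝ}
    (hx : ∀ θ, HasDerivAt x (P.qq θ * y θ) θ)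
    (hy : ∀ θ, HasDerivAt y (-(lam * P.pp θ * x θ)) θ) : P.IsSolution lam x := by
  have hxc : Continuous x := continuous_iff_continuousAt.2 fun θ => (hx θ).continuousAt
  have := P.contDiff_pp.continuous
  refine ⟨contDiff_two_of_hasDerivAt hx hy (by fun_prop), fun θ => ?_⟩
  rw [slOp_eq_of_hasDerivAt hx hy, div_eq_iff (P.pp_pos θ).ne']
  ring

theorem IsSolution.linear_combination {lam : ℝ} {u₁ u₂ : ℝ → ℝ} (h₁ : P.IsSolution lam u₁)
    (h₂ : P.IsSolution lam u₂) (c₁ c₂ : ℝ) :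
    P.IsSolution lam (fun θ => c₁ * u₁ θ + c₂ * u₂ θ) ∧
      P.flux (fun θ => c₁ * u₁ θ + c₂ * u₂ θ) = fun θ => c₁ * P.flux u₁ θ + c₂ * P.flux u₂ θ := by
  have hx : ∀ θ, HasDerivAt (fun θ => c₁ * u₁ θ + c₂ * u₂ θ)
      (P.qq θ * (c₁ * P.flux u₁ θ + c₂ * P.flux u₂ θ)) θ := fun θ =>
    (((h₁.hasDerivAt θ).const_mul c₁).add ((h₂.hasDerivAt θ).const_mul c₂)).congr_deriv (by ring)
  have hy : ∀ θ, HasDerivAt (fun θ => c₁ * P.flux u₁ θ + c₂ * P.flux u₂ θ)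
      (-(lam * P.pp θ * (c₁ * u₁ θ + c₂ * u₂ θ))) θ := fun θ =>
    (((h₁.hasDerivAt_flux θ).const_mul c₁).add
      ((h₂.hasDerivAt_flux θ).const_mul c₂)).congr_deriv (by ring)
  exact ⟨isSolution_of_hasDerivAt hx hy, flux_eq_of_hasDerivAt hx⟩

theorem IsSolution.wronskian_eq {lam : ℝ} {u₁ u₂ : ℝ → ℝ} (h₁ : P.IsSolution lam u₁)
    (h₂ : P.IsSolution lam u₂) (θ θ' : ℝ) :
    u₁ θ * P.flux u₂ θ - u₂ θ * P.flux u₁ θ = u₁ θ' * P.flux u₂ θ' - u₂ θ' * P.flux u₁ θ' := by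
  have hd : ∀ θ, HasDerivAt (fun θ => u₁ θ * P.flux u₂ θ - u₂ θ * P.flux u₁ θ) 0 θ := fun θ =>
    (((h₁.hasDerivAt θ).mul (h₂.hasDerivAt_flux θ)).sub
      ((h₂.hasDerivAt θ).mul (h₁.hasDerivAt_flux θ))).congr_deriv (by ring)
  exact is_const_of_deriv_eq_zero (fun θ => (hd θ).differentiableAt) (fun θ => (hd θ).deriv) θ θ'

theorem IsSolution.comp_add {lam c : ℝ} (hp : ∀ θ, P.pp (θ + c) = P.pp θ)
    (hq : ∀ θ, P.qq (θ + c) = P.qq θ) {u : ℝ → ℝ} (h : P.IsSolution lam u) :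
    P.IsSolution lam (fun θ => u (θ + c)) ∧
      P.flux (fun θ => u (θ + c)) = fun θ => P.flux u (θ + c) := by
  have hx : ∀ θ, HasDerivAt (fun θ => u (θ + c)) (P.qq θ * P.flux u (θ + c)) θ := fun θ =>
    ((h.hasDerivAt (θ + c)).comp_add_const θ c).congr_deriv (by rw [hq])
  have hy : ∀ θ, HasDerivAt (fun θ => P.flux u (θ + c)) (-(lam * P.pp θ * u (θ + c))) θ := fun θ =>
    ((h.hasDerivAt_flux (θ + c)).comp_add_const θ c).congr_deriv (by rw [hp])
  exact ⟨isSolution_of_hasDerivAt hx hy, flux_eq_of_hasDerivAt hx⟩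

variable (P)

/-- The Prüfer radius of the solution with initial angle `a` and initial radius `1`. -/
def radius (lam a θ : ℝ) : ℝ :=
  Real.exp (∫ t in (0 : ℝ)..θ, (lam * P.pp t - P.qq t) *
    (Real.sin (P.angle lam a t) * Real.cos (P.angle lam a t)))

theorem radius_pos (lam a θ : ℝ) : 0 < P.radius lam a θ := Real.exp_pos _

theorem radius_zero (lam a : ℝ) : P.radius lam a 0 = 1 := by simp [radius]

theorem hasDerivAt_radius (lam a θ : ℝ) :
    HasDerivAt (P.radius lam a) (P.radius lam a θ * ((lam * P.pp θ - P.qq θ) *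
      (Real.sin (P.angle lam a θ) * Real.cos (P.angle lam a θ)))) θ := by
  have h1 := P.contDiff_pp.continuous
  have h2 := P.contDiff_qq.continuous
  have h3 := P.continuous_angle lam a
  have hc : Continuous fun t => (lam * P.pp t - P.qq t) *
    (Real.sin (P.angle lam a t) * Real.cos (P.angle lam a t)) := by fun_prop
  exact (hc.integral_hasStrictDerivAt 0 θ).hasDerivAt.exp

/-- The solution with initial phase vector `(cos a, -sin a)`. -/
def sol (lam a θ : ℝ) : ℝ := P.radius lam a θ * Real.cos (P.angle lam a θ)

theorem hasDerivAt_sol (lam a θ : ℝ) : HasDerivAt (P.sol lam a)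
    (P.qq θ * -(P.radius lam a θ * Real.sin (P.angle lam a θ))) θ := by
  refine ((P.hasDerivAt_radius lam a θ).mul (P.hasDerivAt_angle lam a θ).cos).congr_deriv ?_
  rw [angleField]
  have h := Real.sin_sq_add_cos_sq (P.angle lam a θ)
  linear_combination (-P.radius lam a θ * P.qq θ * Real.sin (P.angle lam a θ)) * h

theorem flux_sol (lam a : ℝ) :
    P.flux (P.sol lam a) = fun θ => -(P.radius lam a θ * Real.sin (P.angle lam a θ)) :=
  flux_eq_of_hasDerivAt (P.hasDerivAt_sol lam a)

theorem isSolution_sol (lam a : ℝ) : P.IsSolution lam (P.sol lam a) := by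
  refine isSolution_of_hasDerivAt (P.hasDerivAt_sol lam a) fun θ => ?_
  refine ((P.hasDerivAt_radius lam a θ).mul
    (P.hasDerivAt_angle lam a θ).sin).neg.congr_deriv ?_
  rw [angleField, sol]
  have h := Real.sin_sq_add_cos_sq (P.angle lam a θ)
  linear_combination (-P.radius lam a θ * lam * P.pp θ * Real.cos (P.angle lam a θ)) * h

theorem sol_zero (lam a : ℝ) : P.sol lam a 0 = Real.cos a := by
  simp [sol, radius_zero, angle_zero]

theorem flux_sol_zero (lam a : ℝ) : P.flux (P.sol lam a) 0 = -Real.sin a := by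
  simp [flux_sol, radius_zero, angle_zero]

variable {P}

/-- The Wronskians of `u` with `P.sol lam 0` and `P.sol lam (π / 2)` vanish, while these two have
Wronskian `-1`; eliminating the fluxes leaves `u θ = 0`. -/
theorem IsSolution.eq_zero {lam : ℝ} {u : ℝ → ℝ} (h : P.IsSolution lam u) (h0 : u 0 = 0)
    (h1 : P.flux u 0 = 0) : u = 0 := by
  funext θ
  have e0 := h.wronskian_eq (P.isSolution_sol lam 0) θ 0
  have e1 := h.wronskian_eq (P.isSolution_sol lam (Real.pi / 2)) θ 0
  have e2 := (P.isSolution_sol lam 0).wronskian_eq (P.isSolution_sol lam (Real.pi / 2)) θ 0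
  simp only [h0, h1, sol_zero, flux_sol_zero, zero_mul, mul_zero, sub_zero, Real.cos_zero,
    Real.sin_zero, Real.sin_pi_div_two, Real.cos_pi_div_two, neg_zero] at e0 e1 e2
  change u θ = 0
  linear_combination u θ * e2 + P.sol lam (Real.pi / 2) θ * e0 - P.sol lam 0 θ * e1

theorem IsSolution.ext {lam : ℝ} {u₁ u₂ : ℝ → ℝ} (h₁ : P.IsSolution lam u₁)
    (h₂ : P.IsSolution lam u₂) (h0 : u₁ 0 = u₂ 0) (h1 : P.flux u₁ 0 = P.flux u₂ 0) : u₁ = u₂ := by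
  obtain ⟨h, hf⟩ := h₁.linear_combination h₂ 1 (-1)
  have := h.eq_zero (by simp [h0]) (by simp only [hf, h1]; ring)
  funext θ
  have := congrFun this θ
  simp only [Pi.zero_apply] at this
  linarith

theorem exists_polar (x y : ℝ) : ∃ r a : ℝ, 0 ≤ r ∧ x = r * Real.cos a ∧ y = r * -Real.sin a := by
  refine ⟨‖(⟨x, -y⟩ : ℂ)‖, Complex.arg ⟨x, -y⟩, norm_nonneg _, ?_, ?_⟩
  · rw [Complex.norm_mul_cos_arg]
  · rw [mul_neg, Complex.norm_mul_sin_arg, neg_neg]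

theorem IsSolution.eq_mul_sol {lam : ℝ} {u : ℝ → ℝ} (h : P.IsSolution lam u) {r a : ℝ}
    (h0 : u 0 = r * Real.cos a) (h1 : P.flux u 0 = r * -Real.sin a) :
    u = (fun θ => r * P.sol lam a θ) ∧ P.flux u = fun θ => r * P.flux (P.sol lam a) θ := by
  obtain ⟨h2, h3⟩ := (P.isSolution_sol lam a).linear_combination (P.isSolution_sol lam a) r 0
  simp only [zero_mul, add_zero] at h2 h3
  have := h.ext h2 (by simp [h0, sol_zero]) (by simp only [h3, h1, flux_sol_zero])
  exact ⟨this, by rw [this, h3]⟩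

theorem IsSolution.exists_eq_mul_sol {lam : ℝ} {u : ℝ → ℝ} (h : P.IsSolution lam u) (hne : u ≠ 0) :
    ∃ r a : ℝ, 0 < r ∧ u = (fun θ => r * P.sol lam a θ) ∧
      P.flux u = fun θ => r * P.flux (P.sol lam a) θ := by
  obtain ⟨r, a, hr, h0, h1⟩ := exists_polar (u 0) (P.flux u 0)
  obtain ⟨h2, h3⟩ := h.eq_mul_sol h0 h1
  refine ⟨r, a, lt_of_le_of_ne hr fun h => hne ?_, h2, h3⟩
  rw [h2, ← h]
  funext θ
  simp

variable (P)

/-- Both sides are the conserved Wronskian of two solutions in polar form, at `θ` and at `0`. -/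
theorem radius_mul_radius_mul_sin (lam a b θ : ℝ) :
    P.radius lam a θ * P.radius lam b θ * Real.sin (P.angle lam a θ - P.angle lam b θ) =
      Real.sin (a - b) := by
  have h := (P.isSolution_sol lam a).wronskian_eq (P.isSolution_sol lam b) θ 0
  simp only [sol_zero, flux_sol_zero] at h
  simp only [flux_sol, sol] at h
  rw [Real.sin_sub, Real.sin_sub]
  linear_combination h

theorem exists_const_of_mem_range_mul_pi {f : ℝ → ℝ} (hf : Continuous f)
    (h : ∀ x, ∃ n : ℤ, f x = n * Real.pi) (x y : ℝ) : f x = f y := by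
  choose n hn using h
  have hc : Continuous n := by
    rw [Int.isClosedEmbedding_coe_real.isInducing.continuous_iff]
    have : ((↑) : ℤ → ℝ) ∘ n = fun x => f x / Real.pi := by
      funext x
      simp [hn x, Real.pi_ne_zero]
    rw [this]
    fun_prop
  rw [hn x, hn y, (IsPreconnected.constant isPreconnected_univ hc.continuousOn trivial trivial :
    n x = n y)]

/-- The index of a solution is given by the increase of its Prüfer angle. -/
theorem mem_indexSet_iff {k : ℕ+} {lam : ℝ} :
    lam ∈ P.indexSet k ↔ ∃ a, P.phase lam a = k * Real.pi := by
  constructor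
  · rintro ⟨u, hu, r, β, hβ, hr, hk⟩
    -- With this initial angle the Prüfer solution is proportional to `u`, so their Wronskian
    -- vanishes and `β + ψ` takes values in `π ℤ`; by continuity it is constant.
    refine ⟨-β 0, ?_⟩
    have hval : ∀ θ, ∃ n : ℤ, β θ + P.angle lam (-β 0) θ = n * Real.pi := by
      intro θ
      have hw := hu.wronskian_eq (P.isSolution_sol lam (-β 0)) θ 0
      obtain ⟨hr0, hu0, hv0⟩ := hr 0
      obtain ⟨hrθ, huθ, hvθ⟩ := hr θ
      change P.flux u 0 = _ at hv0
      change P.flux u θ = _ at hvθ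
      rw [sol_zero, flux_sol_zero, hu0, hv0, Real.cos_neg, Real.sin_neg, huθ, hvθ, flux_sol,
        sol] at hw
      have : r θ * P.radius lam (-β 0) θ * Real.sin (β θ + P.angle lam (-β 0) θ) = 0 := by
        rw [Real.sin_add]
        linear_combination -hw
      have hs := (mul_eq_zero.1 this).resolve_left
        (mul_pos hrθ (P.radius_pos lam (-β 0) θ)).ne'
      obtain ⟨n, hn⟩ := Real.sin_eq_zero_iff.1 hs
      exact ⟨n, hn.symm⟩
    have hconst := exists_const_of_mem_range_mul_pi
      (hβ.add (P.continuous_angle lam (-β 0))) hval Real.pi 0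
    simp only [Pi.add_apply, angle_zero] at hconst
    rw [phase]
    linarith
  · rintro ⟨a, ha⟩
    refine ⟨P.sol lam a, P.isSolution_sol lam a, P.radius lam a, fun θ => -P.angle lam a θ,
      (P.continuous_angle lam a).neg, fun θ => ⟨P.radius_pos lam a θ, ?_, ?_⟩, ?_⟩
    · rw [Real.cos_neg, sol]
    · have := congrFun (P.flux_sol lam a) θ
      rw [flux] at this
      rw [this, Real.sin_neg, mul_neg]
    · simp only [angle_zero]
      rw [phase] at ha
      linarith

theorem sol_eq_linear_combination (lam a θ : ℝ) :
    P.sol lam a θ = Real.cos a * P.sol lam 0 θ + Real.sin a * P.sol lam (Real.pi / 2) θ ∧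
    P.flux (P.sol lam a) θ = Real.cos a * P.flux (P.sol lam 0) θ +
      Real.sin a * P.flux (P.sol lam (Real.pi / 2)) θ := by
  obtain ⟨h1, h2⟩ := (P.isSolution_sol lam 0).linear_combination
    (P.isSolution_sol lam (Real.pi / 2)) (Real.cos a) (Real.sin a)
  have h := (P.isSolution_sol lam a).ext h1 (by simp [sol_zero]) (by
    rw [h2]; simp [flux_sol_zero])
  exact ⟨congrFun h θ, by rw [h, h2]⟩

theorem radius_eq_sqrt (lam a θ : ℝ) :
    P.radius lam a θ = Real.sqrt (P.sol lam a θ ^ 2 + P.flux (P.sol lam a) θ ^ 2) := by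
  simp only [flux_sol, sol]
  refine (Real.sqrt_eq_iff_eq_sq (by positivity) (P.radius_pos lam a θ).le).2 ?_ |>.symm
  linear_combination (P.radius lam a θ ^ 2) * Real.sin_sq_add_cos_sq (P.angle lam a θ)

/-- By linearity `r²` is a quadratic form in `(cos a, sin a)`, and it never vanishes. -/
theorem differentiable_radius (lam θ : ℝ) : Differentiable ℝ fun a => P.radius lam a θ := by
  intro a
  have h : ∀ a, P.sol lam a θ ^ 2 + P.flux (P.sol lam a) θ ^ 2 =
      (Real.cos a * P.sol lam 0 θ + Real.sin a * P.sol lam (Real.pi / 2) θ) ^ 2 +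
      (Real.cos a * P.flux (P.sol lam 0) θ +
        Real.sin a * P.flux (P.sol lam (Real.pi / 2)) θ) ^ 2 := fun a => by
    rw [← (P.sol_eq_linear_combination lam a θ).1, ← (P.sol_eq_linear_combination lam a θ).2]
  have hne : (Real.cos a * P.sol lam 0 θ + Real.sin a * P.sol lam (Real.pi / 2) θ) ^ 2 +
      (Real.cos a * P.flux (P.sol lam 0) θ +
        Real.sin a * P.flux (P.sol lam (Real.pi / 2)) θ) ^ 2 ≠ 0 := by
    rw [← h]
    intro h0
    have := P.radius_pos lam a θ
    rw [radius_eq_sqrt, h0, Real.sqrt_zero] at this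
    exact this.false
  simp only [radius_eq_sqrt, h]
  exact DifferentiableAt.sqrt (by fun_prop) hne

/-- For `b` near `a` the Wronskian identity gives `ψ_b(π) - ψ_a(π) = arcsin (sin (b - a) / (ρ b * ρ
a))`, whose derivative at `b = a` is `1 / ρ a ^ 2`. The derivative of `ρ` drops out since `sin (b -
a)` vanishes there. -/
theorem hasDerivAt_phase (lam a : ℝ) :
    HasDerivAt (P.phase lam) (1 / P.radius lam a Real.pi ^ 2 - 1) a := by
  set ρ := fun b => P.radius lam b Real.pi with hρ
  have hpos : ∀ b, 0 < ρ b := fun b => P.radius_pos lam b Real.pi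
  have hρd : HasDerivAt ρ (deriv ρ a) a := (P.differentiable_radius lam Real.pi a).hasDerivAt
  have hquot : HasDerivAt (fun b => Real.sin (b - a) / (ρ b * ρ a)) (1 / ρ a ^ 2) a := by
    have h1 : HasDerivAt (fun b => Real.sin (b - a)) (Real.cos (a - a) * 1) a :=
      ((hasDerivAt_id a).sub_const a).sin
    have hne := (hpos a).ne'
    refine (h1.div (hρd.mul_const (ρ a)) (mul_pos (hpos a) (hpos a)).ne').congr_deriv ?_
    rw [sub_self, Real.cos_zero, Real.sin_zero]
    field_simp
    ring
  have harc : HasDerivAt (fun b => Real.arcsin (Real.sin (b - a) / (ρ b * ρ a)))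
      (1 / ρ a ^ 2) a := by
    have h2 := Real.hasDerivAt_arcsin (x := Real.sin (a - a) / (ρ a * ρ a)) (by simp) (by simp)
    refine (h2.comp a hquot).congr_deriv ?_
    simp
  have hcont : Continuous fun b => P.angle lam b Real.pi := by
    have := (P.continuous_phase.comp (Continuous.prodMk_right lam)).add continuous_id
    refine this.congr fun b => ?_
    simp [phase]
  have hev : (fun b => P.phase lam b) =ᶠ[𝓝 a] fun b =>
      P.angle lam a Real.pi + Real.arcsin (Real.sin (b - a) / (ρ b * ρ a)) - b := by
    have hlim : Tendsto (fun b => P.angle lam b Real.pi - P.angle lam a Real.pi) (𝓝 a) (𝓝 0) := by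
      have := (hcont.tendsto a).sub_const (P.angle lam a Real.pi)
      simpa using this
    have hpi := Real.pi_pos
    filter_upwards [hlim (Ioo_mem_nhds (by linarith : -(Real.pi / 2) < 0)
      (by linarith : 0 < Real.pi / 2))] with b hb
    rw [← P.radius_mul_radius_mul_sin lam b a Real.pi, mul_div_cancel_left₀ _
      (mul_pos (hpos b) (hpos a)).ne', Real.arcsin_sin hb.1.le hb.2.le, phase]
    ring
  exact ((harc.const_add _).sub (hasDerivAt_id a)).congr_of_eventuallyEq hev

theorem radius_pi_eq_one {lam a : ℝ} (h : IsLocalExtr (P.phase lam) a) :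
    P.radius lam a Real.pi = 1 := by
  have h1 := h.hasDerivAt_eq_zero (P.hasDerivAt_phase lam a)
  have hpos := P.radius_pos lam a Real.pi
  rw [sub_eq_zero, div_eq_one_iff_eq (by positivity)] at h1
  exact (pow_eq_one_iff_of_nonneg hpos.le two_ne_zero).1 h1.symm

/-- Up to sign, `r(π) sin (phase)` is the determinant of the phase vectors at `0` and `π`, which
vanishes when they are parallel. -/
theorem exists_int_of_sol_add_pi {lam a ε : ℝ}
    (h0 : P.sol lam a Real.pi = ε * P.sol lam a 0)
    (h1 : P.flux (P.sol lam a) Real.pi = ε * P.flux (P.sol lam a) 0) :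
    ∃ n : ℤ, P.phase lam a = n * Real.pi := by
  rw [sol_zero, sol] at h0
  rw [flux_sol_zero, flux_sol] at h1
  have : P.radius lam a Real.pi * Real.sin (P.phase lam a) = 0 := by
    rw [phase, Real.sin_sub]
    linear_combination (-Real.cos a) * h1 - Real.sin a * h0
  obtain ⟨n, hn⟩ := Real.sin_eq_zero_iff.1
    ((mul_eq_zero.1 this).resolve_left (P.radius_pos lam a Real.pi).ne')
  exact ⟨n, hn.symm⟩

theorem sol_pi_of_phase_eq {lam a : ℝ} {n : ℤ} (h : P.phase lam a = n * Real.pi)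
    (hr : P.radius lam a Real.pi = 1) :
    P.sol lam a Real.pi = (-1) ^ n * P.sol lam a 0 ∧
      P.flux (P.sol lam a) Real.pi = (-1) ^ n * P.flux (P.sol lam a) 0 := by
  have h' : P.angle lam a Real.pi = a + n * Real.pi := by
    rw [phase] at h
    linarith
  rw [sol_zero, flux_sol_zero, sol, flux_sol, hr, h']
  simp only [hr, h', Real.sin_add_int_mul_pi, Real.cos_add_int_mul_pi]
  constructor <;> ring

variable {P}

theorem IsSolution.add_pi_eq {lam ε : ℝ} {u : ℝ → ℝ} (h : P.IsSolution lam u)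
    (h0 : u Real.pi = ε * u 0) (h1 : P.flux u Real.pi = ε * P.flux u 0) (θ : ℝ) :
    u (θ + Real.pi) = ε * u θ := by
  obtain ⟨h2, h3⟩ := h.comp_add P.pp_add_pi P.qq_add_pi
  obtain ⟨h4, h5⟩ := h.linear_combination h ε 0
  simp only [zero_mul, add_zero] at h4 h5
  exact congrFun (h2.ext h4 (by simp [h0]) (by simp [h3, h5, h1])) θ

end

end NormedPlane

/-- The integral is the time in which the autonomous comparison angle advances by `π`. The integrand
is dominated by `1 / m` and tends to `0` except where the cosine vanishes. -/
theorem tendsto_integral_inv_sin_sq_add_mul_cos_sq {m : ℝ} (hm : 0 < m) :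
    Tendsto (fun n : ℕ => ∫ x in (0 : ℝ)..Real.pi,
      1 / (m * Real.sin x ^ 2 + (n + 1) * m * Real.cos x ^ 2)) atTop (𝓝 0) := by
  have hle : ∀ (n : ℕ) (x : ℝ), m ≤ m * Real.sin x ^ 2 + (n + 1) * m * Real.cos x ^ 2 := by
    intro n x
    have h := Real.sin_sq_add_cos_sq x
    have h2 : 0 ≤ (n : ℝ) * m * Real.cos x ^ 2 := by positivity
    nlinarith
  suffices h : Tendsto (fun n : ℕ => ∫ x in (0 : ℝ)..Real.pi,
      1 / (m * Real.sin x ^ 2 + (n + 1) * m * Real.cos x ^ 2)) atTop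
      (𝓝 (∫ _ in (0 : ℝ)..Real.pi, (0 : ℝ))) by simpa using h
  refine intervalIntegral.tendsto_integral_filter_of_dominated_convergence (fun _ => 1 / m)
    (μ := MeasureTheory.volume) (Eventually.of_forall fun n => ?_) (Eventually.of_forall fun n =>
      Eventually.of_forall fun x _ => ?_) intervalIntegrable_const ?_
  · refine Continuous.aestronglyMeasurable ?_
    exact continuous_const.div (by fun_prop) fun x => (hm.trans_le (hle n x)).ne'
  · rw [Real.norm_of_nonneg (one_div_nonneg.2 (hm.le.trans (hle n x)))]
    exact one_div_le_one_div_of_le hm (hle n x)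
  · have hne : ∀ᵐ x : ℝ, x ≠ Real.pi / 2 := by
      simp [MeasureTheory.ae_iff]
    filter_upwards [hne] with x hx hmem
    rw [Set.uIoc_of_le Real.pi_pos.le] at hmem
    have hcos : 0 < Real.cos x ^ 2 := by
      refine sq_pos_of_ne_zero fun h => hx ?_
      exact Real.injOn_cos ⟨hmem.1.le, hmem.2⟩ ⟨by positivity, by linarith [Real.pi_pos]⟩
        (h.trans Real.cos_pi_div_two.symm)
    have hat : Tendsto (fun n : ℕ => m * Real.sin x ^ 2 + (n + 1) * m * Real.cos x ^ 2)
        atTop atTop := by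
      refine tendsto_atTop_add_const_left _ _ ?_
      have := (tendsto_atTop_add_const_right atTop (1 : ℝ)
        tendsto_natCast_atTop_atTop).atTop_mul_const (mul_pos hm hcos)
      simpa [mul_assoc] using this
    simp only [one_div]
    exact hat.inv_tendsto_atTop

/-! ### The index sets and the periodic solutions at their endpoints. -/

namespace NormedPlane

noncomputable section

variable (P : NormedPlane)

theorem exists_forall_lt_phase (n : ℕ) :
    ∃ Λ : ℝ, 0 < Λ ∧ ∀ lam, Λ ≤ lam → ∀ a, n * Real.pi < P.phase lam a := by
  obtain ⟨m, M, hm, hM, hb⟩ := P.exists_bounds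
  have hlim := (tendsto_integral_inv_sin_sq_add_mul_cos_sq hm).const_mul (n : ℝ)
  rw [mul_zero] at hlim
  -- For this `N` the comparison angle needs less than time `π` to advance by `n π`.
  obtain ⟨N, hN⟩ := (hlim.eventually (gt_mem_nhds Real.pi_pos)).exists
  set h : ℝ → ℝ := fun x => m * Real.sin x ^ 2 + (N + 1) * m * Real.cos x ^ 2 with hh
  have hpos : ∀ x, 0 < h x := by
    intro x
    have h1 := Real.sin_sq_add_cos_sq x
    have h2 : 0 ≤ (N : ℝ) * m * Real.cos x ^ 2 := by positivity
    simp only [hh]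
    nlinarith
  have hc : Continuous fun x => 1 / h x :=
    continuous_const.div (by fun_prop) fun x => (hpos x).ne'
  have hper : Function.Periodic (fun x => 1 / h x) Real.pi := by
    intro x
    simp [hh, Real.sin_add_pi, Real.cos_add_pi]
  refine ⟨N + 1, by positivity, fun lam hlam a => ?_⟩
  by_contra! hle
  set ψ := P.angle lam a
  -- `F` is the clock of the comparison equation. The true angle moves at least as fast, so `F (ψ θ)
  -- - θ` is monotone, whereas a phase of at most `n π` would leave `F (ψ π) < π`.
  set F : ℝ → ℝ := fun y => ∫ x in a..y, 1 / h x with hF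
  have hder : ∀ θ, HasDerivAt (fun θ => F (ψ θ) - θ)
      (1 / h (ψ θ) * P.angleField lam θ (ψ θ) - 1) θ := fun θ =>
    (((hc.integral_hasStrictDerivAt a (ψ θ)).hasDerivAt).comp θ
      (P.hasDerivAt_angle lam a θ)).sub (hasDerivAt_id θ)
  have hmono : Monotone fun θ => F (ψ θ) - θ := by
    refine monotone_of_hasDerivAt_nonneg hder fun θ => ?_
    have h1 : h (ψ θ) ≤ P.angleField lam θ (ψ θ) := by
      obtain ⟨b1, -, b2, -⟩ := hb θ
      simp only [hh, angleField]
      gcongr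
      exact (by positivity : (0 : ℝ) ≤ N + 1).trans hlam
    change 0 ≤ _ - _
    rw [sub_nonneg, one_div_mul_eq_div, one_le_div (hpos _)]
    exact h1
  have h1 := hmono Real.pi_pos.le
  simp only [ψ, angle_zero] at h1
  have h2 : F a = 0 := by simp [hF]
  have h3 : F (P.angle lam a Real.pi) ≤ F (a + n • Real.pi) := by
    have hFm : Monotone F := monotone_of_hasDerivAt_nonneg
      (fun y => (hc.integral_hasStrictDerivAt a y).hasDerivAt)
      fun y => (one_div_pos.2 (hpos y)).le
    apply hFm
    rw [phase] at hle
    rw [nsmul_eq_mul]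
    linarith
  have h4 : F (a + n • Real.pi) = n * ∫ x in (0 : ℝ)..Real.pi, 1 / h x := by
    have := hper.intervalIntegral_add_zsmul_eq (n : ℤ) a (fun _ _ => hc.intervalIntegrable _ _)
    rw [natCast_zsmul, natCast_zsmul, nsmul_eq_mul n (∫ _ in _.._, _)] at this
    rw [hF]
    simp only
    rw [this, hper.intervalIntegral_add_eq a 0, zero_add]
  linarith

theorem indexSet_pos {k : ℕ+} {lam : ℝ} (h : lam ∈ P.indexSet k) : 0 < lam := by
  obtain ⟨a, ha⟩ := P.mem_indexSet_iff.1 h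
  by_contra! hl
  have h1 := P.phase_lt_pi hl a
  have h2 : (1 : ℝ) ≤ k := by exact_mod_cast k.pos
  have h3 := mul_le_mul_of_nonneg_right h2 Real.pi_pos.le
  linarith

theorem continuous_phase_left (a : ℝ) : Continuous fun lam => P.phase lam a :=
  P.continuous_phase.comp (Continuous.prodMk_left a)

theorem continuous_phase_right (lam : ℝ) : Continuous (P.phase lam) :=
  P.continuous_phase.comp (Continuous.prodMk_right lam)

theorem exists_phase_eq {lam a b c : ℝ} (ha : P.phase lam a ≤ c) (hb : c ≤ P.phase lam b) :
    ∃ d, P.phase lam d = c :=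
  mem_range_of_exists_le_of_exists_ge (P.continuous_phase_right lam) ⟨a, ha⟩ ⟨b, hb⟩

theorem indexSet_nonempty (k : ℕ+) : (P.indexSet k).Nonempty := by
  obtain ⟨Λ, hΛ, h⟩ := P.exists_forall_lt_phase k
  have h1 := P.phase_lt_pi le_rfl 0
  have h2 : (1 : ℝ) ≤ k := by exact_mod_cast k.pos
  have h3 := mul_le_mul_of_nonneg_right h2 Real.pi_pos.le
  obtain ⟨lam, hlam⟩ := mem_range_of_exists_le_of_exists_ge (c := (k : ℝ) * Real.pi)
    (P.continuous_phase_left 0) ⟨0, by linarith⟩ ⟨Λ, (h Λ le_rfl 0).le⟩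
  exact ⟨lam, P.mem_indexSet_iff.2 ⟨0, hlam⟩⟩

/-- Since `a` matters only modulo `π` and `lam` is confined to `[0, Λ]`, the set is the projection
of a compact part of a level set of the phase. -/
theorem isCompact_indexSet (k : ℕ+) : IsCompact (P.indexSet k) := by
  obtain ⟨Λ, hΛ, h⟩ := P.exists_forall_lt_phase k
  have hK : IsCompact ((Set.Icc 0 Λ ×ˢ Set.Icc 0 Real.pi) ∩
      {x : ℝ × ℝ | P.phase x.1 x.2 = k * Real.pi}) :=
    (isCompact_Icc.prod isCompact_Icc).inter_right
      (isClosed_eq P.continuous_phase continuous_const)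
  convert hK.image continuous_fst using 1
  ext lam
  constructor
  · intro hlam
    obtain ⟨a, ha⟩ := P.mem_indexSet_iff.1 hlam
    obtain ⟨b, hb, -, hab⟩ := P.exists_mem_Ico_phase a
    refine ⟨(lam, b), ⟨⟨⟨(P.indexSet_pos hlam).le, ?_⟩, hb.1, hb.2.le⟩, ?_⟩, rfl⟩
    · by_contra! hl
      have := h lam hl.le a
      rw [ha] at this
      exact this.false
    · exact (hab lam).symm.trans ha
  · rintro ⟨⟨l, b⟩, ⟨-, hb⟩, rfl⟩
    exact P.mem_indexSet_iff.2 ⟨b, hb⟩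

/-- If a phase exceeded `k π`, it would still do so for a slightly smaller parameter, at which the
phase at `b` is already below `k π`. An intermediate initial angle would then put that smaller
parameter into the index set. -/
theorem phase_le_of_isLeast {k : ℕ+} {lam : ℝ} (h : IsLeast (P.indexSet k) lam) (a : ℝ) :
    P.phase lam a ≤ k * Real.pi := by
  by_contra! hlt
  obtain ⟨b, hb⟩ := P.mem_indexSet_iff.1 h.1
  have hev : ∀ᶠ l in 𝓝[<] lam, (k : ℝ) * Real.pi < P.phase l a :=
    ((P.continuous_phase_left a).tendsto lam).mono_left nhdsWithin_le_nhds |>.eventually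
      (lt_mem_nhds hlt)
  obtain ⟨l, hl, hlam⟩ := (hev.and self_mem_nhdsWithin).exists
  have hlam' : l < lam := hlam
  obtain ⟨d, hd⟩ := P.exists_phase_eq ((P.phase_strictMono b hlam').le.trans_eq hb) hl.le
  exact (h.2 (P.mem_indexSet_iff.2 ⟨d, hd⟩)).not_gt hlam'

theorem le_phase_of_isGreatest {k : ℕ+} {lam : ℝ} (h : IsGreatest (P.indexSet k) lam) (a : ℝ) :
    k * Real.pi ≤ P.phase lam a := by
  by_contra! hlt
  obtain ⟨b, hb⟩ := P.mem_indexSet_iff.1 h.1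
  have hev : ∀ᶠ l in 𝓝[>] lam, P.phase l a < (k : ℝ) * Real.pi :=
    ((P.continuous_phase_left a).tendsto lam).mono_left nhdsWithin_le_nhds |>.eventually
      (gt_mem_nhds hlt)
  obtain ⟨l, hl, hlam⟩ := (hev.and self_mem_nhdsWithin).exists
  have hlam' : lam < l := hlam
  obtain ⟨d, hd⟩ := P.exists_phase_eq hl.le (hb.symm.trans_le (P.phase_strictMono b hlam').le)
  exact (h.2 (P.mem_indexSet_iff.2 ⟨d, hd⟩)).not_gt hlam'

theorem isLeast_of_phase_le {k : ℕ+} {lam : ℝ} (hm : lam ∈ P.indexSet k)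
    (h : ∀ a, P.phase lam a ≤ k * Real.pi) : IsLeast (P.indexSet k) lam := by
  refine ⟨hm, fun l hl => ?_⟩
  by_contra! hlt
  obtain ⟨a, ha⟩ := P.mem_indexSet_iff.1 hl
  exact ((P.phase_strictMono a hlt).trans_le (h a)).ne ha

theorem isGreatest_of_le_phase {k : ℕ+} {lam : ℝ} (hm : lam ∈ P.indexSet k)
    (h : ∀ a, k * Real.pi ≤ P.phase lam a) : IsGreatest (P.indexSet k) lam := by
  refine ⟨hm, fun l hl => ?_⟩
  by_contra! hlt
  obtain ⟨a, ha⟩ := P.mem_indexSet_iff.1 hl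
  exact ((h a).trans_lt (P.phase_strictMono a hlt)).ne' ha

theorem exists_mem_Ico_phase_add (a b : ℝ) : ∃ c ∈ Set.Ico a (a + Real.pi),
    (∃ n : ℤ, c = b + n * Real.pi) ∧ ∀ lam, P.phase lam b = P.phase lam c := by
  obtain ⟨n, hn, -⟩ := existsUnique_add_zsmul_mem_Ico Real.pi_pos b a
  rw [zsmul_eq_mul] at hn
  exact ⟨_, hn, ⟨n, rfl⟩, fun lam => (P.phase_add_int_mul_pi lam b n).symm⟩

/-- Modulo `π` the second initial angle lies in `[a, a + π)`, and trajectories keep their order, so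
the final angles also differ by less than `π`. This makes the index sets disjoint. -/
theorem abs_phase_sub_phase_lt (lam a b : ℝ) : |P.phase lam a - P.phase lam b| < Real.pi := by
  obtain ⟨c, hc, -, hbc⟩ := P.exists_mem_Ico_phase_add a b
  rw [hbc lam, phase, phase]
  have h1 := P.angle_le_angle (le_refl lam) hc.1 Real.pi_pos.le
  have h2 := P.angle_lt_angle_of_lt_initial (lam := lam) hc.2 Real.pi_pos.le
  have h3 := P.angle_add_int_mul_pi lam a 1 Real.pi
  simp only [Int.cast_one, one_mul] at h3
  have := hc.1
  have := hc.2
  rw [abs_lt]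
  constructor <;> linarith

theorem eq_of_mem_indexSet {j k : ℕ+} {lam : ℝ} (hj : lam ∈ P.indexSet j)
    (hk : lam ∈ P.indexSet k) : j = k := by
  obtain ⟨a, ha⟩ := P.mem_indexSet_iff.1 hj
  obtain ⟨b, hb⟩ := P.mem_indexSet_iff.1 hk
  have h := P.abs_phase_sub_phase_lt lam a b
  rw [ha, hb, ← sub_mul, abs_mul, abs_of_pos Real.pi_pos] at h
  have h1 : |(j : ℝ) - k| < 1 := by
    by_contra! h1
    have := mul_le_mul_of_nonneg_right h1 Real.pi_pos.le
    linarith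
  have h2 : |((j : ℕ) : ℤ) - ((k : ℕ) : ℤ)| < 1 := by exact_mod_cast h1
  rw [Int.abs_lt_one_iff, sub_eq_zero] at h2
  exact PNat.eq (by exact_mod_cast h2)

theorem periodic_sol {lam a : ℝ} {n : ℤ} (h : P.phase lam a = n * Real.pi)
    (hr : P.radius lam a Real.pi = 1) : Function.Periodic (P.sol lam a) (2 * Real.pi) := by
  obtain ⟨h0, h1⟩ := P.sol_pi_of_phase_eq h hr
  have hadd := (P.isSolution_sol lam a).add_pi_eq h0 h1
  intro θ
  rw [two_mul, ← add_assoc, hadd, hadd, ← mul_assoc, ← zpow_add₀ (by norm_num),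
    Even.neg_one_zpow ⟨n, rfl⟩, one_mul]

/-- At an endpoint of the index set the value `k π` is an extremum of the phase in `a`, so the
radius returns to `1`. -/
theorem exists_periodic_of_isLeast_or_isGreatest {k : ℕ+} {lam : ℝ}
    (h : IsLeast (P.indexSet k) lam ∨ IsGreatest (P.indexSet k) lam) :
    ∃ a, Function.Periodic (P.sol lam a) (2 * Real.pi) := by
  have hm : lam ∈ P.indexSet k := h.elim (·.1) (·.1)
  obtain ⟨a, ha⟩ := P.mem_indexSet_iff.1 hm
  refine ⟨a, P.periodic_sol (n := (k : ℕ)) (by exact_mod_cast ha) (P.radius_pi_eq_one ?_)⟩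
  rcases h with h | h
  · exact Or.inr (Eventually.of_forall fun b => (P.phase_le_of_isLeast h b).trans_eq ha.symm)
  · exact Or.inl (Eventually.of_forall fun b => ha.trans_le (P.le_phase_of_isGreatest h b))

theorem periodic_of_isLeast_of_isGreatest {k : ℕ+} {lam : ℝ}
    (h : IsLeast (P.indexSet k) lam) (h' : IsGreatest (P.indexSet k) lam) (a : ℝ) :
    Function.Periodic (P.sol lam a) (2 * Real.pi) := by
  have hk : ∀ b, P.phase lam b = k * Real.pi := fun b =>
    le_antisymm (P.phase_le_of_isLeast h b) (P.le_phase_of_isGreatest h' b)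
  refine P.periodic_sol (n := (k : ℕ)) (by exact_mod_cast hk a) (P.radius_pi_eq_one ?_)
  exact Or.inl (Eventually.of_forall fun b => ((hk a).trans (hk b).symm).le)

/-! ### Positive periodic eigenvalues are endpoints of index sets. -/

variable {P}

theorem IsSolution.exists_eq_of_wronskian_ne_zero {lam : ℝ} {u v z : ℝ → ℝ}
    (hu : P.IsSolution lam u) (hv : P.IsSolution lam v) (hz : P.IsSolution lam z)
    (hW : u 0 * P.flux v 0 - v 0 * P.flux u 0 ≠ 0) :
    ∃ c₁ c₂ : ℝ, z = fun θ => c₁ * u θ + c₂ * v θ := by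
  set W := u 0 * P.flux v 0 - v 0 * P.flux u 0 with hWdef
  refine ⟨(z 0 * P.flux v 0 - v 0 * P.flux z 0) / W,
    (u 0 * P.flux z 0 - z 0 * P.flux u 0) / W, ?_⟩
  obtain ⟨h1, h2⟩ := hu.linear_combination hv ((z 0 * P.flux v 0 - v 0 * P.flux z 0) / W)
    ((u 0 * P.flux z 0 - z 0 * P.flux u 0) / W)
  refine hz.ext h1 ?_ ?_
  · field_simp
    rw [hWdef]
    ring
  · rw [h2]
    field_simp
    rw [hWdef]
    ring

theorem IsSolution.exists_eq_smul_of_wronskian_eq_zero {lam : ℝ} {u v : ℝ → ℝ}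
    (hu : P.IsSolution lam u) (hv : P.IsSolution lam v) (hv0 : v ≠ 0)
    (hW : u 0 * P.flux v 0 - v 0 * P.flux u 0 = 0) : ∃ c : ℝ, u = fun θ => c * v θ := by
  by_cases h : v 0 = 0
  · have h' : P.flux v 0 ≠ 0 := fun h' => hv0 (hv.eq_zero h h')
    obtain ⟨h1, h2⟩ := hv.linear_combination hv (P.flux u 0 / P.flux v 0) 0
    simp only [zero_mul, add_zero] at h1 h2
    refine ⟨_, hu.ext h1 ?_ ?_⟩
    · rw [h] at hW ⊢
      simpa [h'] using hW
    · rw [h2]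
      field_simp
  · obtain ⟨h1, h2⟩ := hv.linear_combination hv (u 0 / v 0) 0
    simp only [zero_mul, add_zero] at h1 h2
    refine ⟨_, hu.ext h1 ?_ ?_⟩
    · field_simp
    · rw [h2]
      field_simp
      linarith

theorem IsSolution.symmetrize {lam : ℝ} {u : ℝ → ℝ} (hu : P.IsSolution lam u)
    (hper : Function.Periodic u (2 * Real.pi)) {ε : ℝ} (hε : ε * ε = 1) :
    P.IsSolution lam (fun θ => u θ + ε * u (θ + Real.pi)) ∧
      (∀ θ, (u (θ + Real.pi) + ε * u (θ + Real.pi + Real.pi)) =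
        ε * (u θ + ε * u (θ + Real.pi))) := by
  obtain ⟨h1, -⟩ := hu.comp_add P.pp_add_pi P.qq_add_pi
  obtain ⟨h2, -⟩ := hu.linear_combination h1 1 ε
  simp only [one_mul] at h2
  refine ⟨h2, fun θ => ?_⟩
  rw [add_assoc, ← two_mul, hper]
  linear_combination -u (θ + Real.pi) * hε

theorem flux_add_pi {u : ℝ → ℝ} {ε : ℝ} (h : ∀ θ, u (θ + Real.pi) = ε * u θ) (θ : ℝ) :
    P.flux u (θ + Real.pi) = ε * P.flux u θ := by
  rw [flux, flux, P.qq_add_pi, ← deriv_comp_add_const u Real.pi θ, funext h,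
    deriv_const_mul_field, mul_div_assoc]

/-- If all solutions are `2π`-periodic, then the phase is a constant multiple of `π`. -/
theorem exists_phase_eq_of_forall_periodic {lam : ℝ}
    (h : ∀ a, Function.Periodic (P.sol lam a) (2 * Real.pi)) :
    ∀ a b, P.phase lam a = P.phase lam b := by
  suffices hs : ∃ ε : ℝ, ∀ a θ, P.sol lam a (θ + Real.pi) = ε * P.sol lam a θ by
    obtain ⟨ε, hε⟩ := hs
    refine exists_const_of_mem_range_mul_pi (P.continuous_phase_right lam) fun a => ?_
    refine exists_int_of_sol_add_pi (ε := ε) P ?_ ?_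
    · simpa using hε a 0
    · simpa using flux_add_pi (hε a) 0
  -- Otherwise the solution plane contains a nonzero `π`-antiperiodic `u` and a nonzero `π`-periodic
  -- `v`. A shift by `π` reverses the sign of their conserved Wronskian, so `u` is a multiple of `v`
  -- and must vanish.
  by_contra! hcon
  obtain ⟨a, θ₁, ha⟩ := hcon 1
  obtain ⟨b, θ₂, hb⟩ := hcon (-1)
  obtain ⟨hu, hu'⟩ := (P.isSolution_sol lam a).symmetrize (h a) (ε := -1) (by norm_num)
  obtain ⟨hv, hv'⟩ := (P.isSolution_sol lam b).symmetrize (h b) (ε := 1) (by norm_num)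
  set u : ℝ → ℝ := fun θ => P.sol lam a θ + -1 * P.sol lam a (θ + Real.pi) with hudef
  set v : ℝ → ℝ := fun θ => P.sol lam b θ + 1 * P.sol lam b (θ + Real.pi) with hvdef
  have hv0 : v ≠ 0 := by
    intro h0
    have := congrFun h0 θ₂
    simp only [hvdef, Pi.zero_apply] at this
    exact hb (by linarith)
  replace hu' : ∀ θ, u (θ + Real.pi) = -1 * u θ := hu'
  replace hv' : ∀ θ, v (θ + Real.pi) = 1 * v θ := hv'
  have hW := hu.wronskian_eq hv (0 + Real.pi) 0
  have e1 := hu' 0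
  have e2 := hv' 0
  rw [flux_add_pi hu' 0, flux_add_pi hv' 0, e1, e2] at hW
  obtain ⟨c, hc⟩ := hu.exists_eq_smul_of_wronskian_eq_zero hv hv0 (by linarith)
  have h1 := hu' θ₁
  have h2 := hv' θ₁
  have h3 : u θ₁ = c * v θ₁ := congrFun hc θ₁
  have h4 : u (θ₁ + Real.pi) = c * v (θ₁ + Real.pi) := congrFun hc _
  have hz : u θ₁ = 0 := by
    rw [h2] at h4
    linarith
  simp only [hudef] at hz
  exact ha (by linarith)

/-- An eigenvalue in the `k`-th index set with two independent periodic eigenfunctions is the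
only element of this set. -/
theorem IsSolution.isLeast_and_isGreatest {k : ℕ+} {lam : ℝ} {u v : ℝ → ℝ}
    (hm : lam ∈ P.indexSet k) (hu : P.IsSolution lam u) (hv : P.IsSolution lam v)
    (hpu : Function.Periodic u (2 * Real.pi)) (hpv : Function.Periodic v (2 * Real.pi))
    (hW : u 0 * P.flux v 0 - v 0 * P.flux u 0 ≠ 0) :
    IsLeast (P.indexSet k) lam ∧ IsGreatest (P.indexSet k) lam := by
  have hall : ∀ a, Function.Periodic (P.sol lam a) (2 * Real.pi) := by
    intro a θ
    obtain ⟨c₁, c₂, hc⟩ := hu.exists_eq_of_wronskian_ne_zero hv (P.isSolution_sol lam a) hW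
    simp only [hc, hpu θ, hpv θ]
  have hconst := exists_phase_eq_of_forall_periodic hall
  obtain ⟨a, ha⟩ := P.mem_indexSet_iff.1 hm
  exact ⟨P.isLeast_of_phase_le hm fun b => (hconst b a).trans_le ha.le,
    P.isGreatest_of_le_phase hm fun b => ha.symm.le.trans (hconst a b).le⟩

variable (P)

/-- If the monodromy has the eigenvalue `ε = ±1`, the phase lies on one side of its value there. -/
theorem exists_radius_mul_sin_phase_eq {lam a ε : ℝ} (hε : ε * ε = 1)
    (h0 : P.sol lam a Real.pi = ε * P.sol lam a 0)
    (h1 : P.flux (P.sol lam a) Real.pi = ε * P.flux (P.sol lam a) 0) :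
    ∃ c : ℝ, ∀ b, P.radius lam b Real.pi * Real.sin (P.phase lam b) = c * Real.sin (b - a) ^ 2 := by
  -- In the basis with initial angles `a` and `a + π / 2` the monodromy is triangular, with first
  -- diagonal entry `ε`; `(S, F)` is its second column in standard coordinates. The constant below
  -- is minus the off-diagonal entry.
  set S := P.sol lam (a + Real.pi / 2) Real.pi with hS
  set F := P.flux (P.sol lam (a + Real.pi / 2)) Real.pi with hF
  refine ⟨-(Real.cos a * S - Real.sin a * F), fun b => ?_⟩
  have hdet := (P.isSolution_sol lam a).wronskian_eq (P.isSolution_sol lam (a + Real.pi / 2))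
    Real.pi 0
  rw [h0, h1, ← hS, ← hF] at hdet
  simp only [sol_zero, flux_sol_zero] at hdet h0 h1
  rw [Real.sin_add_pi_div_two, Real.cos_add_pi_div_two] at hdet
  have hcomb : P.sol lam b Real.pi =
      Real.cos (b - a) * P.sol lam a Real.pi + Real.sin (b - a) * S ∧
      P.flux (P.sol lam b) Real.pi =
        Real.cos (b - a) * P.flux (P.sol lam a) Real.pi + Real.sin (b - a) * F := by
    obtain ⟨h2, h3⟩ := (P.isSolution_sol lam a).linear_combination
      (P.isSolution_sol lam (a + Real.pi / 2)) (Real.cos (b - a)) (Real.sin (b - a))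
    have he := (P.isSolution_sol lam b).ext h2 (by
      simp only [sol_zero, Real.cos_add_pi_div_two]
      rw [show Real.cos b = Real.cos ((b - a) + a) by rw [sub_add_cancel], Real.cos_add]
      ring) (by
      simp only [h3, flux_sol_zero, Real.sin_add_pi_div_two]
      rw [show Real.sin b = Real.sin ((b - a) + a) by rw [sub_add_cancel], Real.sin_add]
      ring)
    exact ⟨by rw [he], by rw [he, h3]⟩
  have hsin : P.radius lam b Real.pi * Real.sin (P.phase lam b) =
      -Real.cos b * P.flux (P.sol lam b) Real.pi - Real.sin b * P.sol lam b Real.pi := by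
    rw [phase, Real.sin_sub, flux_sol, sol]
    ring
  have ha := Real.sin_sq_add_cos_sq a
  -- The determinant is `1` and `ε² = 1`, so the second diagonal entry is `ε` as well.
  have hkey : Real.cos a * F + Real.sin a * S = -ε := by
    linear_combination ε * hdet - (Real.cos a * F + Real.sin a * S) * hε - ε * ha
  have hS' : S = -ε * Real.sin a + (Real.cos a * S - Real.sin a * F) * Real.cos a := by
    linear_combination Real.sin a * hkey - S * ha
  have hF' : F = -ε * Real.cos a - (Real.cos a * S - Real.sin a * F) * Real.sin a := by
    linear_combination Real.cos a * hkey - F * ha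
  set c := Real.cos a * S - Real.sin a * F
  rw [hsin, hcomb.1, hcomb.2, h0, h1, hS', hF', Real.sin_sub, Real.cos_sub]
  ring

theorem isLeast_or_isGreatest_of_sol {lam a ε : ℝ} (hlam : 0 < lam) (hε : ε * ε = 1)
    (h0 : P.sol lam a Real.pi = ε * P.sol lam a 0)
    (h1 : P.flux (P.sol lam a) Real.pi = ε * P.flux (P.sol lam a) 0) :
    ∃ k : ℕ+, IsLeast (P.indexSet k) lam ∨ IsGreatest (P.indexSet k) lam := by
  obtain ⟨n, hn⟩ := P.exists_int_of_sol_add_pi h0 h1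
  have hpos := P.phase_pos hlam a
  rw [hn, mul_pos_iff_of_pos_right Real.pi_pos] at hpos
  have hn0 : 0 < n := by exact_mod_cast hpos
  obtain ⟨k, rfl⟩ : ∃ k : ℕ+, n = (k : ℕ) :=
    ⟨⟨n.toNat, by omega⟩, by simp [hn0.le]⟩
  simp only [Int.cast_natCast] at hn
  have hm : lam ∈ P.indexSet k := P.mem_indexSet_iff.2 ⟨a, hn⟩
  obtain ⟨c, hc⟩ := P.exists_radius_mul_sin_phase_eq hε h0 h1
  have hsin : ∀ b, P.radius lam b Real.pi * Real.sin (P.phase lam b - P.phase lam a) =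
      (-1) ^ (k : ℕ) * c * Real.sin (b - a) ^ 2 := by
    intro b
    rw [hn, Real.sin_sub_nat_mul_pi, mul_left_comm, hc]
    ring
  have habs := fun b => abs_lt.1 (P.abs_phase_sub_phase_lt lam b a)
  refine ⟨k, ?_⟩
  -- Phases differ by less than `π`, so the sign of the sine in `hsin` is the sign of the phase
  -- difference. The sign of the constant thus decides whether `k π` is the largest or the smallest
  -- phase.
  rcases le_total ((-1) ^ (k : ℕ) * c) 0 with hle | hle
  · refine Or.inl (P.isLeast_of_phase_le hm fun b => ?_)
    by_contra! hlt
    have h2 := Real.sin_pos_of_pos_of_lt_pi (x := P.phase lam b - P.phase lam a)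
      (by linarith) (habs b).2
    have h3 := mul_pos (P.radius_pos lam b Real.pi) h2
    rw [hsin] at h3
    exact h3.not_ge (mul_nonpos_of_nonpos_of_nonneg hle (sq_nonneg _))
  · refine Or.inr (P.isGreatest_of_le_phase hm fun b => ?_)
    by_contra! hlt
    have h2 := Real.sin_neg_of_neg_of_neg_pi_lt (x := P.phase lam b - P.phase lam a)
      (by linarith) (habs b).1
    have h3 := mul_neg_of_pos_of_neg (P.radius_pos lam b Real.pi) h2
    rw [hsin] at h3
    exact h3.not_ge (mul_nonneg hle (sq_nonneg _))

variable {P}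

/-- A positive periodic eigenvalue is the least or the greatest element of some index set. -/
theorem IsSolution.isLeast_or_isGreatest {lam : ℝ} {u : ℝ → ℝ} (hlam : 0 < lam)
    (hu : P.IsSolution lam u) (hper : Function.Periodic u (2 * Real.pi)) (hne : u ≠ 0) :
    ∃ k : ℕ+, IsLeast (P.indexSet k) lam ∨ IsGreatest (P.indexSet k) lam := by
  -- The `π`-periodic and `π`-antiperiodic parts of `u` cannot both vanish, as their sum is a
  -- multiple of `u`.
  obtain ⟨ε, hε, hz⟩ : ∃ ε : ℝ, ε * ε = 1 ∧ (fun θ => u θ + ε * u (θ + Real.pi)) ≠ 0 := by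
    by_contra! hcon
    have h1 := hcon 1 (by norm_num)
    have h2 := hcon (-1) (by norm_num)
    refine hne (funext fun θ => ?_)
    have e1 := congrFun h1 θ
    have e2 := congrFun h2 θ
    simp only [Pi.zero_apply] at e1 e2 ⊢
    linarith
  obtain ⟨hs, hs'⟩ := hu.symmetrize hper hε
  set z : ℝ → ℝ := fun θ => u θ + ε * u (θ + Real.pi) with hzdef
  obtain ⟨r, a, hr, hza, hfa⟩ := hs.exists_eq_mul_sol hz
  have e1 : z (0 + Real.pi) = ε * z 0 := hs' 0
  have e2 : P.flux z (0 + Real.pi) = ε * P.flux z 0 := flux_add_pi hs' 0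
  rw [zero_add, hza] at e1
  rw [zero_add, hfa] at e2
  refine P.isLeast_or_isGreatest_of_sol (a := a) hlam hε ?_ ?_
  · exact mul_left_cancel₀ hr.ne' (by linear_combination e1)
  · exact mul_left_cancel₀ hr.ne' (by linear_combination e2)

end

end NormedPlane

/-! ### Compact symmetric operators on an incomplete inner product space. -/

section CompactSymmetric

open UniformSpace

variable {E : Type*} [NormedAddCommGroup E] [InnerProductSpace ℝ E]

/-- The continuous extension of an operator to the completion. -/
noncomputable def ContinuousLinearMap.toCompletion (G : E →L[ℝ] E) :
    Completion E →L[ℝ] Completion E :=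
  ((Completion.toComplL (𝕜 := ℝ)).comp G).extend (Completion.toComplL (𝕜 := ℝ))

theorem ContinuousLinearMap.toCompletion_coe (G : E →L[ℝ] E) (x : E) :
    G.toCompletion (x : Completion E) = (G x : Completion E) :=
  ContinuousLinearMap.extend_eq ((Completion.toComplL (𝕜 := ℝ)).comp G) (e := Completion.toComplL)
    Completion.denseRange_coe (Completion.isUniformInducing_coe E) x

theorem ContinuousLinearMap.toCompletion_isSymmetric {G : E →L[ℝ] E}
    (hG : ∀ x y, ⟪G x, y⟫_ℝ = ⟪x, G y⟫_ℝ) : G.toCompletion.IsSymmetric := by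
  intro x y
  induction x, y using Completion.induction_on₂ with
  | hp =>
    exact isClosed_eq ((G.toCompletion.continuous.comp continuous_fst).inner continuous_snd)
      (continuous_fst.inner (G.toCompletion.continuous.comp continuous_snd))
  | ih x y =>
    change ⟪G.toCompletion x, y⟫_ℝ = ⟪(x : Completion E), G.toCompletion y⟫_ℝ
    rw [toCompletion_coe, toCompletion_coe, Completion.inner_coe, Completion.inner_coe, hG]

/-- The unit ball of `E` is dense in that of the completion, and the image of a compact `K` of `E`
is closed there, so no limits outside `E` appear. The extension is thus compact and maps into `E`.
-/
theorem ContinuousLinearMap.exists_isCompact_toCompletion_mem {G : E →L[ℝ] E}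
    (hG : IsCompactOperator G) : ∃ K : Set E, IsCompact K ∧
      ∀ x ∈ Metric.ball (0 : Completion E) 1, G.toCompletion x ∈ ((↑) : E → Completion E) '' K := by
  obtain ⟨K, hK, hKs⟩ := IsCompactOperator.image_ball_subset_compact
    (f := (G : E →ₗ[ℝ] E)) hG 1
  refine ⟨K, hK, fun x hx => ?_⟩
  have hcl : IsClosed (((↑) : E → Completion E) '' K) :=
    (hK.image (Completion.continuous_coe E)).isClosed
  have h1 := Completion.denseRange_coe.open_subset_closure_inter
    (Metric.isOpen_ball (x := (0 : Completion E)) (ε := 1)) hx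
  refine hcl.closure_subset (map_mem_closure G.toCompletion.continuous h1 ?_)
  rintro - ⟨hz, y, rfl⟩
  refine ⟨G y, hKs ⟨y, ?_, rfl⟩, (G.toCompletion_coe y).symm⟩
  simpa using hz

theorem ContinuousLinearMap.toCompletion_mem_range {G : E →L[ℝ] E}
    (hG : IsCompactOperator G) (x : Completion E) : ∃ y : E, G.toCompletion x = y := by
  obtain ⟨K, -, hK⟩ := exists_isCompact_toCompletion_mem hG
  have hpos : 0 < ‖x‖ + 1 := by positivity
  obtain ⟨z, -, hz⟩ := hK ((‖x‖ + 1)⁻¹ • x) (by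
    rw [mem_ball_zero_iff, norm_smul, norm_inv, Real.norm_of_nonneg hpos.le,
      inv_mul_lt_one₀ hpos]
    exact lt_add_one _)
  refine ⟨(‖x‖ + 1) • z, ?_⟩
  rw [Completion.coe_smul, hz, map_smul, smul_inv_smul₀ hpos.ne']

/-- A vector of the completion which is orthogonal to all eigenvectors of a compact symmetric
operator with nonzero eigenvalue is orthogonal to the range of the operator. -/
theorem ContinuousLinearMap.inner_range_eq_zero {G : E →L[ℝ] E} (hG : IsCompactOperator G)
    (hs : ∀ x y, ⟪G x, y⟫_ℝ = ⟪x, G y⟫_ℝ) {v : Completion E}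
    (hv : ∀ μ : ℝ, μ ≠ 0 → ∀ x : E, G x = μ • x → ⟪(x : Completion E), v⟫_ℝ = 0) (x : E) :
    ⟪(G x : Completion E), v⟫_ℝ = 0 := by
  have hsym := toCompletion_isSymmetric hs
  have hcomp : IsCompactOperator G.toCompletion := by
    obtain ⟨K, hK, hKs⟩ := exists_isCompact_toCompletion_mem hG
    exact ⟨_, hK.image (Completion.continuous_coe E),
      Filter.mem_of_superset (Metric.ball_mem_nhds 0 one_pos) hKs⟩
  have hbot := ContinuousLinearMap.orthogonalComplement_iSup_eigenspaces_eq_bot hcomp hsym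
  have hmem : G.toCompletion v ∈
      (⨆ μ, Module.End.eigenspace (G.toCompletion : Module.End ℝ (Completion E)) μ)ᗮ := by
    rw [← Submodule.iInf_orthogonal, Submodule.mem_iInf]
    intro μ
    rw [Submodule.mem_orthogonal]
    intro w hw
    rw [Module.End.mem_eigenspace_iff] at hw
    replace hw : G.toCompletion w = μ • w := hw
    have h1 : ⟪w, G.toCompletion v⟫_ℝ = ⟪G.toCompletion w, v⟫_ℝ := (hsym w v).symm
    rw [h1, hw, inner_smul_left]
    -- For `μ = 0` the pairing is zero at once; for `μ ≠ 0` the eigenvector is a multiple of its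
    -- image and hence lies in `E`, where `hv` applies.
    by_cases hμ : μ = 0
    · simp [hμ]
    · obtain ⟨y, hy⟩ := toCompletion_mem_range hG w
      have hw' : w = ((μ⁻¹ • y : E) : Completion E) := by
        rw [Completion.coe_smul, ← hy, hw, inv_smul_smul₀ hμ]
      rw [hw', hv μ hμ, mul_zero]
      rw [hw', toCompletion_coe, ← Completion.coe_smul] at hw
      exact Completion.coe_injective E hw
  rw [hbot, Submodule.mem_bot] at hmem
  have h1 : ⟪G.toCompletion x, v⟫_ℝ = ⟪(x : Completion E), G.toCompletion v⟫_ℝ := hsym x v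
  rw [← toCompletion_coe, h1, hmem, inner_zero_right]

/-- An orthonormal family of an inner product space that has trivial orthogonal complement in the
completion is an orthonormal basis. -/
theorem Orthonormal.hasSum_of_forall_completion {ι : Type*} {b : ι → E} (hb : Orthonormal ℝ b)
    (h : ∀ v : Completion E, (∀ i, ⟪(b i : Completion E), v⟫_ℝ = 0) → v = 0) (f : E) :
    HasSum (fun i => ⟪b i, f⟫_ℝ • b i) f := by
  have hb' : Orthonormal ℝ fun i => (b i : Completion E) :=
    hb.comp_linearIsometry (Completion.toComplₗᵢ (𝕜 := ℝ))
  let B := HilbertBasis.mkOfOrthogonalEqBot hb' (by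
    rw [Submodule.eq_bot_iff]
    intro v hv
    rw [Submodule.mem_orthogonal] at hv
    exact h v fun i => hv _ (Submodule.subset_span ⟨i, rfl⟩))
  have hB : ∀ i, B i = (b i : Completion E) := fun i => by
    simp [B, HilbertBasis.mkOfOrthogonalEqBot, HilbertBasis.coe_mk]
  have hsum := B.hasSum_repr (f : Completion E)
  simp only [HilbertBasis.repr_apply_apply, hB, Completion.inner_coe, ← Completion.coe_smul] at hsum
  rw [HasSum, (Completion.isUniformInducing_coe E).isInducing.tendsto_nhds_iff]
  refine hsum.congr fun s => ?_
  exact (map_sum (Completion.toComplL (𝕜 := ℝ) (E := E)) _ s).symm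

end CompactSymmetric

/-! ### Symmetry of `T`, the compact Green operator and density of the domain. -/

theorem Function.Periodic.periodic_primitive {g : ℝ → ℝ} {c : ℝ} (hg : Continuous g)
    (hper : Function.Periodic g c) (h0 : ∫ t in (0 : ℝ)..c, g t = 0) :
    Function.Periodic (fun θ => ∫ t in (0 : ℝ)..θ, g t) c := by
  intro θ
  have h1 := intervalIntegral.integral_add_adjacent_intervals (μ := MeasureTheory.volume)
    (hg.intervalIntegrable 0 θ) (hg.intervalIntegrable θ (θ + c))
  have h2 := hper.intervalIntegral_add_eq θ 0
  simp only [zero_add] at h2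
  rw [h2, h0, add_zero] at h1
  exact h1.symm

theorem abs_integral_mul_le {f w : ℝ → ℝ} {a b B : ℝ} (hab : a ≤ b) (hw : Continuous w)
    (hw0 : ∀ x, 0 ≤ w x) (hB : ∀ x ∈ Set.Icc a b, |f x| ≤ B) :
    |∫ x in a..b, f x * w x| ≤ B * ∫ x in a..b, w x := by
  rw [← intervalIntegral.integral_const_mul, ← Real.norm_eq_abs]
  refine intervalIntegral.norm_integral_le_of_norm_le hab (Eventually.of_forall fun x hx => ?_)
    ((hw.const_mul B).intervalIntegrable _ _)
  rw [norm_mul, Real.norm_of_nonneg (hw0 x)]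
  exact mul_le_mul_of_nonneg_right (hB x (Set.Ioc_subset_Icc_self hx)) (hw0 x)

namespace NormedPlane

noncomputable section

variable {P : NormedPlane}

theorem C0.ext {f g : P.C0} (h : ∀ θ, f θ = g θ) : f = g := Subtype.ext (funext h)

theorem inner_eq (f g : P.C0) : ⟪f, g⟫_ℝ = ∫ θ in (0 : ℝ)..(2 * Real.pi), f θ * g θ * P.pp θ := rfl

theorem norm_sq_eq (f : P.C0) :
    ‖f‖ ^ 2 = ∫ θ in (0 : ℝ)..(2 * Real.pi), f θ * f θ * P.pp θ := by
  rw [← real_inner_self_eq_norm_sq, inner_eq]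

theorem C0.smul_apply (c : ℝ) (f : P.C0) (θ : ℝ) : (c • f) θ = c * f θ := rfl

theorem one_apply (θ : ℝ) : P.one θ = 1 := rfl

theorem inner_one_left (f : P.C0) :
    ⟪P.one, f⟫_ℝ = ∫ θ in (0 : ℝ)..(2 * Real.pi), f θ * P.pp θ := by
  simp only [inner_eq, one_apply, one_mul]

theorem mem_L0_iff {f : P.C0} : f ∈ P.L0 ↔ ⟪P.one, f⟫_ℝ = 0 := by
  rw [inner_one_left]
  rfl

theorem mem_domain_iff {f : P.C0} : f ∈ P.T.domain ↔ ContDiff ℝ 2 (f : ℝ → ℝ) := Iff.rfl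

theorem T_apply (h : P.T.domain) (θ : ℝ) : P.T h θ = -P.slOp (h : P.C0) θ := rfl

theorem one_ne_zero : P.one ≠ 0 := by
  intro h
  have : P.one 0 = (0 : P.C0) 0 := by rw [h]
  exact _root_.one_ne_zero (α := ℝ) this

theorem norm_one_pos : 0 < ‖P.one‖ := norm_pos_iff.2 one_ne_zero

theorem norm_one_sq : ‖P.one‖ ^ 2 = ∫ θ in (0 : ℝ)..(2 * Real.pi), P.pp θ := by
  simp only [norm_sq_eq, one_apply, one_mul]

theorem norm_le_of_forall_abs_le {f : P.C0} {B : ℝ} (hB0 : 0 ≤ B)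
    (hB : ∀ θ ∈ Set.Icc 0 (2 * Real.pi), |f θ| ≤ B) : ‖f‖ ≤ B * ‖P.one‖ := by
  have h : ‖f‖ ^ 2 ≤ (B * ‖P.one‖) ^ 2 := by
    rw [norm_sq_eq, mul_pow, norm_one_sq]
    refine (le_abs_self _).trans (abs_integral_mul_le (by positivity) P.contDiff_pp.continuous
      (fun θ => (P.pp_pos θ).le) fun θ hθ => ?_)
    rw [abs_mul, sq]
    exact mul_le_mul (hB θ hθ) (hB θ hθ) (abs_nonneg _) hB0
  exact (sq_le_sq₀ (norm_nonneg _) (by positivity)).1 h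

theorem periodic_flux {u : ℝ → ℝ} (hu : Function.Periodic u (2 * Real.pi)) :
    Function.Periodic (P.flux u) (2 * Real.pi) := fun θ => by
  rw [flux, flux, P.periodic_qq θ, periodic_deriv hu θ]

/-- Integration by parts; the boundary terms cancel by periodicity. The right side is a symmetric
nonnegative form, which gives symmetry and positivity of `T`. -/
theorem inner_T_right (h₁ h₂ : P.T.domain) : ⟪(h₁ : P.C0), P.T h₂⟫_ℝ =
    ∫ θ in (0 : ℝ)..(2 * Real.pi),
      P.qq θ * (P.flux (h₁ : P.C0) θ * P.flux (h₂ : P.C0) θ) := by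
  have hd₁ : ContDiff ℝ 2 ((h₁ : P.C0) : ℝ → ℝ) := h₁.2
  have hd₂ : ContDiff ℝ 2 ((h₂ : P.C0) : ℝ → ℝ) := h₂.2
  have c1 : Continuous (P.flux (h₁ : P.C0)) := (P.contDiff_flux hd₁).continuous
  have c2 : Continuous (P.flux (h₂ : P.C0)) := (P.contDiff_flux hd₂).continuous
  have c5 := P.contDiff_qq.continuous
  have hder : ∀ θ, HasDerivAt (fun θ => (h₁ : P.C0) θ * P.flux (h₂ : P.C0) θ)
      (P.qq θ * (P.flux (h₁ : P.C0) θ * P.flux (h₂ : P.C0) θ) -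
        (h₁ : P.C0) θ * P.T h₂ θ * P.pp θ) θ := fun θ =>
    ((hasDerivAt_of_contDiff_two hd₁ θ).mul
      (hasDerivAt_flux_of_contDiff_two hd₂ θ)).congr_deriv (by rw [T_apply]; ring)
  have i1 : IntervalIntegrable (fun θ => P.qq θ * (P.flux (h₁ : P.C0) θ * P.flux (h₂ : P.C0) θ))
      MeasureTheory.volume 0 (2 * Real.pi) := (c5.mul (c1.mul c2)).intervalIntegrable _ _
  have i2 := C0.intervalIntegrable (h₁ : P.C0) (P.T h₂)
  have h := intervalIntegral.integral_eq_sub_of_hasDerivAt (a := 0) (b := 2 * Real.pi)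
    (fun θ _ => hder θ) (i1.sub i2)
  rw [intervalIntegral.integral_sub i1 i2] at h
  have e1 := (h₁ : P.C0).periodic 0
  have e2 := periodic_flux (h₂ : P.C0).periodic (P := P) 0
  rw [zero_add] at e1 e2
  rw [e1, e2, sub_self, sub_eq_zero] at h
  rw [inner_eq, h]

theorem inner_T_symm (h₁ h₂ : P.T.domain) :
    ⟪(h₁ : P.C0), P.T h₂⟫_ℝ = ⟪P.T h₁, (h₂ : P.C0)⟫_ℝ := by
  rw [inner_T_right, real_inner_comm, inner_T_right]
  congr 1
  funext θ
  ring

theorem inner_T_self_nonneg (h : P.T.domain) : 0 ≤ ⟪(h : P.C0), P.T h⟫_ℝ := by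
  rw [inner_T_right]
  exact intervalIntegral.integral_nonneg (by positivity) fun θ _ =>
    mul_nonneg (P.qq_pos θ).le (mul_self_nonneg _)

theorem one_mem_domain : P.one ∈ P.T.domain :=
  mem_domain_iff.2 (contDiff_const : ContDiff ℝ 2 fun _ : ℝ => (1 : ℝ))

theorem T_one : P.T ⟨P.one, one_mem_domain⟩ = 0 := by
  refine C0.ext fun θ => ?_
  change -P.slOp (fun _ => 1) θ = 0
  simp [slOp]

theorem T_mem_L0 (h : P.T.domain) : P.T h ∈ P.L0 := by
  have := inner_T_symm (⟨P.one, one_mem_domain⟩ : P.T.domain) h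
  rw [T_one, inner_zero_left] at this
  exact mem_L0_iff.2 this

theorem T_eq_smul_iff {h : P.T.domain} {lam : ℝ} :
    P.T h = lam • (h : P.C0) ↔ P.IsSolution lam (h : P.C0) := by
  constructor
  · intro hT
    refine ⟨h.2, fun θ => ?_⟩
    have := congrArg (fun f : P.C0 => f θ) hT
    simp only [T_apply, C0.smul_apply] at this
    linarith
  · intro hs
    refine C0.ext fun θ => ?_
    rw [T_apply, hs.2, C0.smul_apply]
    ring

/-- The flux is constant, and periodicity forces this constant to be `0` because `∫ [q, q'] > 0`. So
the function is constant, and its mean is zero. -/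
theorem eq_zero_of_T_eq_zero {h : P.T.domain} (hT : P.T h = 0) (h0 : (h : P.C0) ∈ P.L0) :
    (h : P.C0) = 0 := by
  have hs : P.IsSolution 0 (h : P.C0) := T_eq_smul_iff.1 (by rw [hT, zero_smul])
  have hflux : ∀ θ, P.flux (h : P.C0) θ = P.flux (h : P.C0) 0 := fun θ =>
    is_const_of_deriv_eq_zero (fun θ => (hs.hasDerivAt_flux θ).differentiableAt)
      (fun θ => by rw [(hs.hasDerivAt_flux θ).deriv]; simp) θ 0
  have hint := intervalIntegral.integral_eq_sub_of_hasDerivAt (a := 0) (b := 2 * Real.pi)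
    (fun θ _ => hs.hasDerivAt θ) (by
      simp only [hflux]
      exact (P.contDiff_qq.continuous.mul continuous_const).intervalIntegrable _ _)
  have e1 := (h : P.C0).periodic 0
  rw [zero_add] at e1
  simp only [hflux] at hint
  rw [e1, sub_self, intervalIntegral.integral_mul_const] at hint
  have hq : 0 < ∫ θ in (0 : ℝ)..(2 * Real.pi), P.qq θ :=
    intervalIntegral.intervalIntegral_pos_of_pos
      (P.contDiff_qq.continuous.intervalIntegrable _ _) P.qq_pos (by positivity)
  have hf0 : P.flux (h : P.C0) 0 = 0 := (mul_eq_zero.1 hint).resolve_left hq.ne'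
  have hconst : ∀ θ, (h : P.C0) θ = (h : P.C0) 0 := fun θ =>
    is_const_of_deriv_eq_zero (fun θ => (hs.hasDerivAt θ).differentiableAt)
      (fun θ => by rw [(hs.hasDerivAt θ).deriv, hflux, hf0, mul_zero]) θ 0
  rw [mem_L0_iff, inner_one_left] at h0
  simp only [hconst] at h0
  rw [intervalIntegral.integral_const_mul, ← norm_one_sq] at h0
  have h00 : (h : P.C0) 0 = 0 := (mul_eq_zero.1 h0).resolve_right (pow_pos norm_one_pos 2).ne'
  exact C0.ext fun θ => (hconst θ).trans h00

theorem T_injOn_L0 {h₁ h₂ : P.T.domain} (hT : P.T h₁ = P.T h₂) (h₁0 : (h₁ : P.C0) ∈ P.L0)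
    (h₂0 : (h₂ : P.C0) ∈ P.L0) : (h₁ : P.C0) = h₂ := by
  have := eq_zero_of_T_eq_zero (h := h₁ - h₂) (by rw [LinearPMap.map_sub, hT, sub_self])
    (P.L0.sub_mem h₁0 h₂0)
  exact sub_eq_zero.1 this

theorem integral_abs_mul_le (f : P.C0) :
    ∫ θ in (0 : ℝ)..(2 * Real.pi), |f θ| * P.pp θ ≤ ‖P.one‖ * ‖f‖ := by
  let g : P.C0 := ⟨fun θ => |f θ|, f.continuous.abs, fun θ => congrArg abs (f.periodic θ)⟩
  have hg : ∀ θ, g θ = |f θ| := fun _ => rfl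
  have h1 : ‖g‖ = ‖f‖ := by
    have : ‖g‖ ^ 2 = ‖f‖ ^ 2 := by
      simp only [norm_sq_eq, hg, abs_mul_abs_self]
    exact (sq_eq_sq₀ (norm_nonneg _) (norm_nonneg _)).1 this
  have h2 := real_inner_le_norm P.one g
  rw [inner_one_left, h1] at h2
  exact h2

variable (P)

/-- The equation `T u = f` can be solved in `L₀`, with a Lipschitz bound for `u`. -/
theorem exists_solution_bound : ∃ C : ℝ, 0 ≤ C ∧ ∀ f ∈ P.L0, ∃ u : P.T.domain,
    P.T u = f ∧ (u : P.C0) ∈ P.L0 ∧ (∀ θ, |(u : P.C0) θ| ≤ C * ‖f‖) ∧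
      ∀ θ θ', |(u : P.C0) θ - (u : P.C0) θ'| ≤ C * ‖f‖ * |θ - θ'| := by
  obtain ⟨m, M, hm, hM, hb⟩ := P.exists_bounds
  have hpi := Real.pi_pos
  have h2pi : (0 : ℝ) < 2 * Real.pi := by positivity
  set C₁ := 2 * ‖P.one‖ * M with hC₁
  have hC₁0 : 0 ≤ C₁ := by positivity
  -- The term `2 * (2 * Real.pi)` bounds the primitive `x₀` together with its mean `d`; the term `1`
  -- covers the Lipschitz bound.
  refine ⟨C₁ * (1 + 2 * (2 * Real.pi)), by positivity, fun f hf => ?_⟩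
  have cp := P.contDiff_pp.continuous
  have cq := P.contDiff_qq.continuous
  have cfp : Continuous fun θ => f θ * P.pp θ := f.continuous.mul cp
  have hfp : Function.Periodic (fun θ => f θ * P.pp θ) (2 * Real.pi) := fun θ => by
    simp only [f.periodic θ, P.periodic_pp θ]
  rw [mem_L0_iff, inner_one_left] at hf
  set F : ℝ → ℝ := fun θ => ∫ t in (0 : ℝ)..θ, f t * P.pp t with hF
  have hFper : Function.Periodic F (2 * Real.pi) := hfp.periodic_primitive cfp hf
  have hFd : ∀ θ, HasDerivAt F (f θ * P.pp θ) θ := fun θ =>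
    (cfp.integral_hasStrictDerivAt 0 θ).hasDerivAt
  have hFc : Continuous F := continuous_iff_continuousAt.2 fun θ => (hFd θ).continuousAt
  set A := ‖P.one‖ * ‖f‖ with hA
  have hA0 : 0 ≤ A := by positivity
  have hFb : ∀ θ, |F θ| ≤ A := by
    intro θ
    obtain ⟨t, ht, hθt⟩ := hFper.exists_mem_Ico₀ h2pi θ
    rw [hθt]
    refine le_trans ?_ (integral_abs_mul_le f)
    refine (intervalIntegral.abs_integral_le_integral_abs ht.1).trans ?_
    simp only [abs_mul, abs_of_pos (P.pp_pos _)]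
    have c : Continuous fun θ => |f θ| * P.pp θ := f.continuous.abs.mul cp
    refine intervalIntegral.integral_mono_interval le_rfl ht.1 ht.2.le
      (Eventually.of_forall fun x => mul_nonneg (abs_nonneg _) (P.pp_pos x).le)
      (c.intervalIntegrable _ _)
  have hq : 0 < ∫ θ in (0 : ℝ)..(2 * Real.pi), P.qq θ :=
    intervalIntegral.intervalIntegral_pos_of_pos (cq.intervalIntegrable _ _) P.qq_pos h2pi
  have hp : 0 < ∫ θ in (0 : ℝ)..(2 * Real.pi), P.pp θ :=
    intervalIntegral.intervalIntegral_pos_of_pos (cp.intervalIntegrable _ _) P.pp_pos h2pi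
  -- The flux is a primitive of `-f [p, p']`; this integration constant gives `[q, q'] y` mean zero,
  -- so that its primitive `x₀` is periodic. The later constant `d` moves the solution into `L₀`.
  set c := (∫ θ in (0 : ℝ)..(2 * Real.pi), F θ * P.qq θ) / ∫ θ in (0 : ℝ)..(2 * Real.pi), P.qq θ
    with hc
  have hcb : |c| ≤ A := by
    rw [hc, abs_div, abs_of_pos hq, div_le_iff₀ hq]
    exact abs_integral_mul_le h2pi.le cq (fun θ => (P.qq_pos θ).le) fun θ _ => hFb θ
  set y : ℝ → ℝ := fun θ => c - F θ with hy
  have hyd : ∀ θ, HasDerivAt y (-(f θ * P.pp θ)) θ := fun θ => (hFd θ).const_sub c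
  have hyc : Continuous y := continuous_const.sub hFc
  have hyb : ∀ θ, |P.qq θ * y θ| ≤ C₁ * ‖f‖ := by
    intro θ
    rw [abs_mul, abs_of_pos (P.qq_pos θ)]
    have h1 : |y θ| ≤ 2 * A := (abs_sub _ _).trans (by linarith [hFb θ])
    calc P.qq θ * |y θ| ≤ M * (2 * A) :=
          mul_le_mul (hb θ).2.2.2 h1 (abs_nonneg _) hM.le
      _ = C₁ * ‖f‖ := by rw [hC₁, hA]; ring
  have cqy : Continuous fun θ => P.qq θ * y θ := cq.mul hyc
  have hqy0 : ∫ θ in (0 : ℝ)..(2 * Real.pi), P.qq θ * y θ = 0 := by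
    have e : ∀ θ, P.qq θ * y θ = c * P.qq θ - F θ * P.qq θ := fun θ => by rw [hy]; ring
    simp only [e]
    have c1 : Continuous fun θ => c * P.qq θ := continuous_const.mul cq
    have c2 : Continuous fun θ => F θ * P.qq θ := hFc.mul cq
    rw [intervalIntegral.integral_sub (c1.intervalIntegrable _ _) (c2.intervalIntegrable _ _), intervalIntegral.integral_const_mul, hc,
      div_mul_cancel₀ _ hq.ne', sub_self]
  set x₀ : ℝ → ℝ := fun θ => ∫ t in (0 : ℝ)..θ, P.qq t * y t with hx₀
  have hx₀per : Function.Periodic x₀ (2 * Real.pi) :=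
    Function.Periodic.periodic_primitive cqy (fun θ => by
      simp only [hy, P.periodic_qq θ, hFper θ]) hqy0
  have hx₀d : ∀ θ, HasDerivAt x₀ (P.qq θ * y θ) θ := fun θ =>
    (cqy.integral_hasStrictDerivAt 0 θ).hasDerivAt
  have hx₀c : Continuous x₀ := continuous_iff_continuousAt.2 fun θ => (hx₀d θ).continuousAt
  have hlip : ∀ θ θ', |x₀ θ - x₀ θ'| ≤ C₁ * ‖f‖ * |θ - θ'| := by
    intro θ θ'
    have := Convex.norm_image_sub_le_of_norm_hasDerivWithin_le (f := x₀)
      (f' := fun θ => P.qq θ * y θ) (s := Set.univ) (C := C₁ * ‖f‖)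
      (fun θ _ => (hx₀d θ).hasDerivWithinAt) (fun θ _ => hyb θ) convex_univ
      (Set.mem_univ θ') (Set.mem_univ θ)
    simpa [Real.norm_eq_abs] using this
  set B := C₁ * ‖f‖ * (2 * Real.pi) with hB
  have hB0 : 0 ≤ B := by positivity
  have hx₀b : ∀ θ, |x₀ θ| ≤ B := by
    intro θ
    obtain ⟨t, ht, hθt⟩ := hx₀per.exists_mem_Ico₀ h2pi θ
    rw [hθt]
    have h1 := hlip t 0
    have h2 : x₀ 0 = 0 := by simp [hx₀]
    rw [h2, sub_zero, sub_zero, abs_of_nonneg ht.1] at h1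
    exact h1.trans (mul_le_mul_of_nonneg_left ht.2.le (by positivity))
  set d := (∫ θ in (0 : ℝ)..(2 * Real.pi), x₀ θ * P.pp θ) / ∫ θ in (0 : ℝ)..(2 * Real.pi), P.pp θ
    with hd
  have hdb : |d| ≤ B := by
    rw [hd, abs_div, abs_of_pos hp, div_le_iff₀ hp]
    exact abs_integral_mul_le h2pi.le cp (fun θ => (P.pp_pos θ).le) fun θ _ => hx₀b θ
  have hxd : ∀ θ, HasDerivAt (fun θ => x₀ θ - d) (P.qq θ * y θ) θ := fun θ =>
    (hx₀d θ).sub_const d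
  let u : P.C0 := ⟨fun θ => x₀ θ - d, hx₀c.sub continuous_const, fun θ =>
    congrArg (· - d) (hx₀per θ)⟩
  have hu : ∀ θ, u θ = x₀ θ - d := fun _ => rfl
  have hud : u ∈ P.T.domain := mem_domain_iff.2 (contDiff_two_of_hasDerivAt hxd hyd cfp.neg)
  refine ⟨⟨u, hud⟩, C0.ext fun θ => ?_, ?_, fun θ => ?_, fun θ θ' => ?_⟩
  · rw [T_apply]
    change -P.slOp (fun θ => x₀ θ - d) θ = f θ
    rw [slOp_eq_of_hasDerivAt hxd hyd, neg_div, neg_neg, mul_div_cancel_right₀ _ (P.pp_pos θ).ne']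
  · rw [mem_L0_iff, inner_one_left]
    simp only [hu, sub_mul]
    have c1 : Continuous fun θ => x₀ θ * P.pp θ := hx₀c.mul cp
    have c2 : Continuous fun θ => d * P.pp θ := continuous_const.mul cp
    rw [intervalIntegral.integral_sub (c1.intervalIntegrable _ _) (c2.intervalIntegrable _ _), intervalIntegral.integral_const_mul, hd,
      div_mul_cancel₀ _ hp.ne', sub_self]
  · simp only [hu]
    calc |x₀ θ - d| ≤ |x₀ θ| + |d| := abs_sub _ _
      _ ≤ B + B := add_le_add (hx₀b θ) hdb
      _ ≤ C₁ * (1 + 2 * (2 * Real.pi)) * ‖f‖ := by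
        have : 0 ≤ C₁ * ‖f‖ := by positivity
        rw [hB]
        linarith
  · simp only [hu, sub_sub_sub_cancel_right]
    refine (hlip θ θ').trans ?_
    gcongr
    exact le_mul_of_one_le_right hC₁0 (by linarith)

/-- The orthogonal projection onto `L₀`. -/
def proj : P.C0 →ₗ[ℝ] P.C0 where
  toFun f := f - (⟪P.one, f⟫_ℝ / ‖P.one‖ ^ 2) • P.one
  map_add' f g := by
    rw [inner_add_right, add_div, add_smul]
    abel
  map_smul' c f := by
    rw [inner_smul_right, RingHom.id_apply, smul_sub, smul_smul, mul_div_assoc]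

theorem proj_apply (f : P.C0) : P.proj f = f - (⟪P.one, f⟫_ℝ / ‖P.one‖ ^ 2) • P.one := rfl

theorem proj_mem (f : P.C0) : P.proj f ∈ P.L0 := by
  rw [mem_L0_iff, proj_apply, inner_sub_right, inner_smul_right, real_inner_self_eq_norm_sq,
    div_mul_cancel₀ _ (pow_pos norm_one_pos 2).ne', sub_self]

variable {P}

theorem proj_eq_self {f : P.C0} (hf : f ∈ P.L0) : P.proj f = f := by
  rw [proj_apply, mem_L0_iff.1 hf, zero_div, zero_smul, sub_zero]

theorem inner_proj_right {f : P.C0} (hf : f ∈ P.L0) (g : P.C0) :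
    ⟪f, P.proj g⟫_ℝ = ⟪f, g⟫_ℝ := by
  rw [proj_apply, inner_sub_right, inner_smul_right, real_inner_comm P.one f, mem_L0_iff.1 hf, mul_zero,
    sub_zero]

theorem norm_proj_le (f : P.C0) : ‖P.proj f‖ ≤ ‖f‖ := by
  have h1 : ‖P.proj f‖ ^ 2 = ⟪P.proj f, f⟫_ℝ := by
    rw [← inner_proj_right (P.proj_mem f), real_inner_self_eq_norm_sq]
  have h2 := real_inner_le_norm (P.proj f) f
  rw [← h1, sq] at h2
  by_cases h : ‖P.proj f‖ = 0
  · rw [h]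
    exact norm_nonneg _
  · exact le_of_mul_le_mul_left h2 (lt_of_le_of_ne (norm_nonneg _) (Ne.symm h))

variable (P)

theorem exists_green : ∃ C : ℝ, 0 ≤ C ∧ ∃ G : P.C0 → P.T.domain, ∀ f,
    P.T (G f) = P.proj f ∧ (G f : P.C0) ∈ P.L0 ∧ (∀ θ, |(G f : P.C0) θ| ≤ C * ‖f‖) ∧
      ∀ θ θ', |(G f : P.C0) θ - (G f : P.C0) θ'| ≤ C * ‖f‖ * |θ - θ'| := by
  obtain ⟨C, hC, h⟩ := P.exists_solution_bound
  choose! G hG using h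
  refine ⟨C, hC, fun f => G (P.proj f), fun f => ?_⟩
  obtain ⟨h1, h2, h3, h4⟩ := hG _ (P.proj_mem f)
  have hle : C * ‖P.proj f‖ ≤ C * ‖f‖ := mul_le_mul_of_nonneg_left (norm_proj_le f) hC
  exact ⟨h1, h2, fun θ => (h3 θ).trans hle,
    fun θ θ' => (h4 θ θ').trans (mul_le_mul_of_nonneg_right hle (abs_nonneg _))⟩

/-- A bound for the Green operator. -/
def greenBound : ℝ := P.exists_green.choose

theorem greenBound_nonneg : 0 ≤ P.greenBound := P.exists_green.choose_spec.1

/-- The value of the Green operator: the solution in `L₀` of the equation `T u = f` modulo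
constants. -/
def greenFun : P.C0 → P.T.domain := P.exists_green.choose_spec.2.choose

theorem greenFun_spec (f : P.C0) : P.T (P.greenFun f) = P.proj f ∧ (P.greenFun f : P.C0) ∈ P.L0 ∧
    (∀ θ, |(P.greenFun f : P.C0) θ| ≤ P.greenBound * ‖f‖) ∧
      ∀ θ θ', |(P.greenFun f : P.C0) θ - (P.greenFun f : P.C0) θ'| ≤
        P.greenBound * ‖f‖ * |θ - θ'| :=
  P.exists_green.choose_spec.2.choose_spec f

/-- The Green operator, which inverts `T` on `L₀` and vanishes on the constants. -/
def green : P.C0 →L[ℝ] P.C0 :=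
  LinearMap.mkContinuous
    { toFun := fun f => P.greenFun f
      map_add' := fun f g => T_injOn_L0 (h₁ := P.greenFun (f + g))
        (h₂ := P.greenFun f + P.greenFun g)
        (by rw [LinearPMap.map_add, (P.greenFun_spec _).1, (P.greenFun_spec _).1, (P.greenFun_spec _).1,
          map_add])
        (P.greenFun_spec _).2.1
        (P.L0.add_mem (P.greenFun_spec _).2.1 (P.greenFun_spec _).2.1)
      map_smul' := fun c f => T_injOn_L0 (h₁ := P.greenFun (c • f)) (h₂ := c • P.greenFun f)
        (by rw [LinearPMap.map_smul, (P.greenFun_spec _).1, (P.greenFun_spec _).1, map_smul])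
        (P.greenFun_spec _).2.1 (P.L0.smul_mem c (P.greenFun_spec _).2.1) }
    (P.greenBound * ‖P.one‖) fun f => by
      have h := norm_le_of_forall_abs_le (f := (P.greenFun f : P.C0))
        (mul_nonneg P.greenBound_nonneg (norm_nonneg f)) fun θ _ => (P.greenFun_spec f).2.2.1 θ
      rw [mul_right_comm]
      exact h

variable {P}

theorem green_mem_domain (f : P.C0) : P.green f ∈ P.T.domain := (P.greenFun f).2

theorem green_mem_L0 (f : P.C0) : P.green f ∈ P.L0 := (P.greenFun_spec f).2.1

theorem T_green (f : P.C0) : P.T ⟨P.green f, green_mem_domain f⟩ = P.proj f :=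
  (P.greenFun_spec f).1

theorem green_T (h : P.T.domain) (h0 : (h : P.C0) ∈ P.L0) : P.green (P.T h) = h :=
  T_injOn_L0 (h₁ := ⟨P.green (P.T h), green_mem_domain _⟩) (h₂ := h)
    (by rw [T_green, proj_eq_self (T_mem_L0 h)]) (green_mem_L0 _) h0

theorem green_symm (f g : P.C0) : ⟪P.green f, g⟫_ℝ = ⟪f, P.green g⟫_ℝ := by
  have h := inner_T_symm (⟨P.green f, green_mem_domain f⟩ : P.T.domain)
    ⟨P.green g, green_mem_domain g⟩
  rw [T_green, T_green] at h
  rw [← inner_proj_right (green_mem_L0 f), h, real_inner_comm, inner_proj_right (green_mem_L0 g),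
    real_inner_comm]

/-- A periodic continuous function induced by a continuous function on the circle. -/
def ofCircle (P : NormedPlane) (F : BoundedContinuousFunction (AddCircle (2 * Real.pi)) ℝ) :
    P.C0 :=
  ⟨fun θ => F (θ : AddCircle (2 * Real.pi)),
    F.continuous.comp (AddCircle.continuous_mk' _), fun θ => by simp⟩

theorem continuous_ofCircle : Continuous P.ofCircle := by
  refine (LipschitzWith.of_dist_le_mul (K := ⟨‖P.one‖, norm_nonneg _⟩) fun F G => ?_).continuous
  rw [dist_eq_norm, mul_comm]
  refine norm_le_of_forall_abs_le dist_nonneg fun θ _ => ?_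
  exact F.dist_coe_le_dist (g := G) (θ : AddCircle (2 * Real.pi))

/-- Arzelà–Ascoli in the sup norm on the circle, carried over by the continuous map to the weaker
norm of the inner product. -/
theorem isCompact_ofCircle_image (B C : ℝ) : IsCompact (P.ofCircle ''
    {F : BoundedContinuousFunction (AddCircle (2 * Real.pi)) ℝ |
      (∀ x, |F x| ≤ B) ∧ ∀ θ θ' : ℝ, |F θ - F θ'| ≤ C * |θ - θ'|}) := by
  have : Fact (0 < 2 * Real.pi) := ⟨by positivity⟩
  refine IsCompact.image ?_ continuous_ofCircle
  refine BoundedContinuousFunction.arzela_ascoli₂ (Set.Icc (-B) B) isCompact_Icc _ ?_ ?_ ?_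
  · rw [Set.ofPred_and, Set.ofPred_forall, Set.ofPred_forall]
    refine (isClosed_iInter fun x => ?_).inter (isClosed_iInter fun θ => ?_)
    · exact isClosed_le (continuous_eval_const x).abs
        continuous_const
    · rw [Set.ofPred_forall]
      refine isClosed_iInter fun θ' => ?_
      exact isClosed_le ((continuous_eval_const (θ : AddCircle (2 * Real.pi))).sub
        (continuous_eval_const (θ' : AddCircle (2 * Real.pi)))).abs continuous_const
  · exact fun F x hF => abs_le.1 (hF.1 x)
  · intro x
    induction x using QuotientAddGroup.induction_on with
    | H θ =>
      rw [Metric.equicontinuousAt_iff_right]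
      intro ε hε
      have hmap : 𝓝 ((θ : ℝ) : AddCircle (2 * Real.pi)) = map (↑) (𝓝 θ) :=
        QuotientAddGroup.nhds_eq _ θ
      rw [hmap, eventually_map]
      have hlim : Tendsto (fun θ' => C * |θ - θ'|) (𝓝 θ) (𝓝 0) := by
        have : Continuous fun θ' => C * |θ - θ'| := by fun_prop
        simpa using this.tendsto θ
      filter_upwards [hlim.eventually (gt_mem_nhds hε)] with θ' hθ' F
      exact (F.2.2 θ θ').trans_lt hθ'

theorem isCompactOperator_green : IsCompactOperator P.green := by
  refine ⟨_, isCompact_ofCircle_image (P := P) P.greenBound P.greenBound,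
    mem_of_superset (Metric.ball_mem_nhds 0 one_pos) fun f hf => ?_⟩
  rw [mem_ball_zero_iff] at hf
  obtain ⟨-, -, h1, h2⟩ := P.greenFun_spec f
  have hper : Function.Periodic (P.green f) (2 * Real.pi) := (P.green f).periodic
  have hcont : Continuous hper.lift :=
    continuous_coinduced_dom.2 (P.green f).continuous
  have : Fact (0 < 2 * Real.pi) := ⟨by positivity⟩
  have hB : P.greenBound * ‖f‖ ≤ P.greenBound :=
    mul_le_of_le_one_right P.greenBound_nonneg hf.le
  refine ⟨BoundedContinuousFunction.mkOfCompact ⟨hper.lift, hcont⟩, ⟨fun x => ?_, fun θ θ' => ?_⟩,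
    C0.ext fun θ => rfl⟩
  · induction x using QuotientAddGroup.induction_on with
    | H θ => exact (h1 θ).trans hB
  · exact (h2 θ θ').trans (mul_le_mul_of_nonneg_right hB (abs_nonneg _))

/-- Convolution with a bump of radius `r` preserves periodicity. Because `r ≤ 1`, uniform continuity
on `[-1, 2π + 1]` suffices. -/
theorem exists_mem_domain_abs_sub_le (f : P.C0) {ε : ℝ} (hε : 0 < ε) :
    ∃ g ∈ P.T.domain, ∀ θ ∈ Set.Icc 0 (2 * Real.pi), |g θ - f θ| ≤ ε := by
  have huc := (isCompact_Icc (a := (-1 : ℝ)) (b := 2 * Real.pi + 1)).uniformContinuousOn_of_continuous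
    f.continuous.continuousOn
  obtain ⟨δ, hδ, hd⟩ := Metric.uniformContinuousOn_iff_le.1 huc ε hε
  set r := min δ 1
  have hr : 0 < r := lt_min hδ one_pos
  let φ : ContDiffBump (0 : ℝ) := ⟨r / 2, r, by positivity, by linarith⟩
  let g : ℝ → ℝ := MeasureTheory.convolution (φ.normed MeasureTheory.volume) f
    (ContinuousLinearMap.lsmul ℝ ℝ) MeasureTheory.volume
  have hg : ContDiff ℝ 2 g :=
    φ.hasCompactSupport_normed.contDiff_convolution_left _ φ.contDiff_normed
      f.continuous.locallyIntegrable
  have hper : Function.Periodic g (2 * Real.pi) := by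
    intro θ
    simp only [g, MeasureTheory.convolution]
    congr 1
    funext t
    rw [add_sub_right_comm, f.periodic]
  refine ⟨⟨g, hg.continuous, hper⟩, mem_domain_iff.2 hg, fun θ hθ => ?_⟩
  refine φ.dist_normed_convolution_le f.continuous.aestronglyMeasurable fun x hx => ?_
  have hx' : |x - θ| < r := hx
  rw [abs_lt] at hx'
  have hr1 : r ≤ 1 := min_le_right _ _
  refine hd x ⟨by linarith [hθ.1], by linarith [hθ.2]⟩ θ ⟨by linarith [hθ.1], by linarith [hθ.2]⟩ ?_
  exact hx.le.trans (min_le_left _ _)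

theorem dense_domain : Dense (P.T.domain : Set P.C0) := by
  refine Metric.dense_iff.2 fun f r hr => ?_
  have hpos := norm_one_pos (P := P)
  obtain ⟨g, hg, hgf⟩ := exists_mem_domain_abs_sub_le f (ε := r / (2 * ‖P.one‖)) (by positivity)
  refine ⟨g, ?_, hg⟩
  rw [Metric.mem_ball, dist_eq_norm]
  have h := norm_le_of_forall_abs_le (f := g - f) (by positivity) hgf
  have h2 : r / (2 * ‖P.one‖) * ‖P.one‖ = r / 2 := by field_simp
  linarith

end

end NormedPlane

/-! ### Self-adjointness, existence of eigensystems and completeness. -/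

namespace NormedPlane

noncomputable section

variable {P : NormedPlane}

/-- Testing against `1` puts `f` in `L₀`. Testing against the Green function of `g - P.green f`
shows that the projection of this difference to `L₀` has norm zero, so `g` is `P.green f` plus a
constant. -/
theorem exists_T_eq_of_forall_inner_eq {g f : P.C0}
    (h : ∀ u : P.T.domain, ⟪g, P.T u⟫_ℝ = ⟪f, (u : P.C0)⟫_ℝ) :
    ∃ hg : g ∈ P.T.domain, P.T ⟨g, hg⟩ = f := by
  have hf : f ∈ P.L0 := by
    have := h ⟨P.one, one_mem_domain⟩
    rw [T_one, inner_zero_right] at this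
    rw [mem_L0_iff, real_inner_comm]
    exact this.symm
  have h1 : P.proj (g - P.green f) = 0 := by
    have h2 := h ⟨P.green (g - P.green f), green_mem_domain _⟩
    rw [T_green] at h2
    have h3 : ⟪g - P.green f, P.proj (g - P.green f)⟫_ℝ = 0 := by
      rw [inner_sub_left, h2, sub_eq_zero]
      change ⟪f, P.green (g - P.green f)⟫_ℝ = _
      rw [inner_proj_right (green_mem_L0 f), ← green_symm]
    rw [real_inner_comm, ← inner_proj_right (P.proj_mem _)] at h3
    exact inner_self_eq_zero.1 h3
  obtain ⟨c, hc⟩ : ∃ c : ℝ, g = P.green f + c • P.one := by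
    rw [proj_apply, sub_eq_zero, sub_eq_iff_eq_add'] at h1
    exact ⟨_, h1⟩
  have hg : g ∈ P.T.domain := by
    rw [hc]
    exact P.T.domain.add_mem (green_mem_domain f) (P.T.domain.smul_mem c one_mem_domain)
  refine ⟨hg, ?_⟩
  have he : (⟨g, hg⟩ : P.T.domain) =
      ⟨P.green f, green_mem_domain f⟩ + c • ⟨P.one, one_mem_domain⟩ := Subtype.ext hc
  rw [he, LinearPMap.map_add, LinearPMap.map_smul, T_green, T_one, smul_zero, add_zero,
    proj_eq_self hf]

theorem isClosed_L0 : IsClosed (P.L0 : Set P.C0) := by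
  have : (P.L0 : Set P.C0) = {f | ⟪P.one, f⟫_ℝ = 0} := Set.ext fun f => mem_L0_iff
  rw [this]
  exact isClosed_eq (continuous_const.inner continuous_id) continuous_const

/-- The inverse of the restriction of `T` to `L₀`. -/
def greenL0 (P : NormedPlane) : P.L0 →L[ℝ] P.L0 :=
  (P.green.comp P.L0.subtypeL).codRestrict P.L0 fun f => green_mem_L0 (f : P.C0)

theorem isCompactOperator_greenL0 : IsCompactOperator P.greenL0 :=
  (isCompactOperator_green.comp_clm P.L0.subtypeL).codRestrict
    (fun f => green_mem_L0 (f : P.C0)) isClosed_L0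

/-- Eigenfunctions with distinct eigenvalues are orthogonal. -/
theorem inner_eq_zero_of_ne {u v : P.T.domain} {lam mu : ℝ} (hu : P.T u = lam • (u : P.C0))
    (hv : P.T v = mu • (v : P.C0)) (hne : lam ≠ mu) : ⟪(u : P.C0), (v : P.C0)⟫_ℝ = 0 := by
  have h := inner_T_symm u v
  rw [hu, hv, inner_smul_left, inner_smul_right, conj_trivial, ← sub_eq_zero, ← sub_mul] at h
  exact (mul_eq_zero.1 h).resolve_left (sub_ne_zero.2 hne.symm)

theorem C0.coe_ne_zero {f : P.C0} (h : f ≠ 0) : (f : ℝ → ℝ) ≠ 0 :=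
  fun h0 => h (Subtype.ext h0)

theorem IsSolution.exists_normalized {lam : ℝ} {u : ℝ → ℝ} (hu : P.IsSolution lam u)
    (hper : Function.Periodic u (2 * Real.pi)) (hne : u ≠ 0) :
    ∃ h : P.C0, (∃ hd : h ∈ P.T.domain, P.T ⟨h, hd⟩ = lam • h) ∧ ‖h‖ = 1 := by
  let f : P.C0 := ⟨u, hu.1.continuous, hper⟩
  have hf : f ∈ P.T.domain := mem_domain_iff.2 hu.1
  have hT : P.T ⟨f, hf⟩ = lam • f := T_eq_smul_iff.2 hu
  have hf0 : f ≠ 0 := fun h0 => hne (congrArg Subtype.val h0)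
  refine ⟨‖f‖⁻¹ • f, ⟨P.T.domain.smul_mem _ hf, ?_⟩, ?_⟩
  · have := P.T.map_smul ‖f‖⁻¹ ⟨f, hf⟩
    rw [hT, smul_comm] at this
    exact this
  · rw [norm_smul, norm_inv, norm_norm, inv_mul_cancel₀ (norm_ne_zero_iff.2 hf0)]

variable (P) in
theorem sol_ne_zero (lam a : ℝ) : P.sol lam a ≠ 0 := by
  intro h
  have h1 : P.flux (P.sol lam a) 0 = 0 := by
    rw [h]
    simp [flux]
  have h2 : P.sol lam a 0 = 0 := congrFun h 0
  rw [flux_sol_zero, neg_eq_zero] at h1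
  rw [sol_zero] at h2
  have := Real.sin_sq_add_cos_sq a
  rw [h1, h2] at this
  norm_num at this

theorem exists_normalized_of_isLeast_or_isGreatest {k : ℕ+} {lam : ℝ}
    (h : IsLeast (P.indexSet k) lam ∨ IsGreatest (P.indexSet k) lam) :
    ∃ h : P.C0, (∃ hd : h ∈ P.T.domain, P.T ⟨h, hd⟩ = lam • h) ∧ ‖h‖ = 1 := by
  obtain ⟨a, ha⟩ := P.exists_periodic_of_isLeast_or_isGreatest h
  exact (P.isSolution_sol lam a).exists_normalized ha (P.sol_ne_zero lam a)

/-- At a double eigenvalue there are two orthonormal eigenfunctions. -/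
theorem exists_orthonormal_pair {k : ℕ+} {lam : ℝ} (hl : IsLeast (P.indexSet k) lam)
    (hg : IsGreatest (P.indexSet k) lam) :
    ∃ h : Fin 2 → P.C0, (∀ i, ∃ hd : h i ∈ P.T.domain, P.T ⟨h i, hd⟩ = lam • h i) ∧
      (∀ i, ‖h i‖ = 1) ∧ ⟪h 0, h 1⟫_ℝ = 0 := by
  have hall := P.periodic_of_isLeast_of_isGreatest hl hg
  let f : ℝ → P.C0 := fun a => ⟨P.sol lam a, (P.isSolution_sol lam a).1.continuous, hall a⟩
  obtain ⟨e, ⟨hed, heT⟩, hen⟩ := (P.isSolution_sol lam 0).exists_normalized (hall 0)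
    (P.sol_ne_zero lam 0)
  -- If every solution were a multiple of `e`, so would be those with initial angles `0` and `π /
  -- 2`, which are independent.
  obtain ⟨a, ha⟩ : ∃ a, f a - ⟪e, f a⟫_ℝ • e ≠ 0 := by
    by_contra! hcon
    have hs : ∀ a, ∃ c : ℝ, P.sol lam a = fun θ => c * e θ := fun a => by
      refine ⟨⟪e, f a⟫_ℝ, funext fun θ => ?_⟩
      exact congrArg (fun u : P.C0 => u θ) (sub_eq_zero.1 (hcon a))
    obtain ⟨c₀, h₀⟩ := hs 0
    obtain ⟨c₁, h₁⟩ := hs (Real.pi / 2)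
    have e0 : P.sol lam 0 0 = c₀ * e 0 := congrFun h₀ 0
    have e1 : P.sol lam (Real.pi / 2) 0 = c₁ * e 0 := congrFun h₁ 0
    rw [sol_zero, Real.cos_zero] at e0
    rw [sol_zero, Real.cos_pi_div_two] at e1
    have hc₁ : c₁ = 0 := by
      refine (mul_eq_zero.1 e1.symm).resolve_right fun h0 => ?_
      rw [h0, mul_zero] at e0
      exact _root_.one_ne_zero e0
    refine P.sol_ne_zero lam (Real.pi / 2) ?_
    rw [h₁, hc₁]
    funext θ
    simp
  set g := f a - ⟪e, f a⟫_ℝ • e with hgdef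
  have hes : P.IsSolution lam e := T_eq_smul_iff.1 heT
  have hgs : P.IsSolution lam g := by
    have := ((P.isSolution_sol lam a).linear_combination hes 1 (-⟪e, f a⟫_ℝ)).1
    convert this using 1
    funext θ
    change P.sol lam a θ - ⟪e, f a⟫_ℝ * e θ = _
    ring
  have hgd : g ∈ P.T.domain := mem_domain_iff.2 hgs.1
  have hgT : P.T ⟨g, hgd⟩ = lam • g := T_eq_smul_iff.2 hgs
  have horth : ⟪e, g⟫_ℝ = 0 := by
    rw [hgdef, inner_sub_right, inner_smul_right, real_inner_self_eq_norm_sq, hen]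
    ring
  refine ⟨![e, ‖g‖⁻¹ • g], ?_, ?_, ?_⟩
  · intro i
    fin_cases i
    · exact ⟨hed, heT⟩
    · refine ⟨P.T.domain.smul_mem _ hgd, ?_⟩
      have := P.T.map_smul ‖g‖⁻¹ ⟨g, hgd⟩
      rw [hgT, smul_comm] at this
      exact this
  · intro i
    fin_cases i
    · exact hen
    · change ‖‖g‖⁻¹ • g‖ = 1
      rw [norm_smul, norm_inv, norm_norm, inv_mul_cancel₀ (norm_ne_zero_iff.2 ha)]
  · change ⟪e, ‖g‖⁻¹ • g⟫_ℝ = 0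
    rw [inner_smul_right, horth, mul_zero]

variable (P) in
theorem exists_isEigensystem : ∃ lam h, P.IsEigensystem lam h := by
  have key : ∀ k : ℕ+, ∃ (lam : Fin 2 → ℝ) (h : Fin 2 → P.C0),
      IsLeast (P.indexSet k) (lam 0) ∧ IsGreatest (P.indexSet k) (lam 1) ∧
      (∀ i, ∃ hd : h i ∈ P.T.domain, P.T ⟨h i, hd⟩ = lam i • h i) ∧ (∀ i, ‖h i‖ = 1) ∧
      (lam 0 = lam 1 → ⟪h 0, h 1⟫_ℝ = 0) := by
    intro k
    obtain ⟨l, hl⟩ := (P.isCompact_indexSet k).exists_isLeast (P.indexSet_nonempty k)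
    obtain ⟨g, hg⟩ := (P.isCompact_indexSet k).exists_isGreatest (P.indexSet_nonempty k)
    by_cases hlg : l = g
    · subst hlg
      obtain ⟨h, h1, h2, h3⟩ := exists_orthonormal_pair hl hg
      refine ⟨fun _ => l, h, hl, hg, h1, h2, fun _ => h3⟩
    · obtain ⟨u, hu, hu1⟩ := exists_normalized_of_isLeast_or_isGreatest (Or.inl hl)
      obtain ⟨v, hv, hv1⟩ := exists_normalized_of_isLeast_or_isGreatest (Or.inr hg)
      refine ⟨![l, g], ![u, v], hl, hg, ?_, ?_, fun h => absurd h hlg⟩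
      · intro i
        fin_cases i
        · exact hu
        · exact hv
      · intro i
        fin_cases i
        · exact hu1
        · exact hv1
  choose lam h h1 h2 h3 h4 h5 using key
  exact ⟨lam, h, ⟨h1, h2, h3, h4, h5⟩⟩

variable {lam : ℕ+ → Fin 2 → ℝ} {h : ℕ+ → Fin 2 → P.C0}

theorem IsEigensystem.mem_indexSet (H : P.IsEigensystem lam h) (k : ℕ+) (i : Fin 2) :
    lam k i ∈ P.indexSet k := by
  fin_cases i
  · exact (H.isLeast k).1
  · exact (H.isGreatest k).1

theorem IsEigensystem.isSolution (H : P.IsEigensystem lam h) (k : ℕ+) (i : Fin 2) :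
    P.IsSolution (lam k i) (h k i) := by
  obtain ⟨hd, hT⟩ := H.eigen k i
  exact T_eq_smul_iff.1 hT

theorem IsEigensystem.ne_zero (H : P.IsEigensystem lam h) (k : ℕ+) (i : Fin 2) : h k i ≠ 0 := by
  rw [← norm_ne_zero_iff, H.norm_eq_one]
  exact _root_.one_ne_zero

theorem IsEigensystem.inner_eq_zero (H : P.IsEigensystem lam h) {k k' : ℕ+} {i i' : Fin 2}
    (hne : (k, i) ≠ (k', i')) : ⟪h k i, h k' i'⟫_ℝ = 0 := by
  obtain ⟨hd, hT⟩ := H.eigen k i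
  obtain ⟨hd', hT'⟩ := H.eigen k' i'
  by_cases hl : lam k i = lam k' i'
  · obtain rfl : k = k' :=
      P.eq_of_mem_indexSet (H.mem_indexSet k i) (hl ▸ H.mem_indexSet k' i')
    have hii : i ≠ i' := fun hii => hne (by rw [hii])
    fin_cases i <;> fin_cases i'
    · exact absurd rfl hii
    · exact H.double k hl
    · rw [real_inner_comm]
      exact H.double k hl.symm
    · exact absurd rfl hii
  · exact inner_eq_zero_of_ne hT hT' hl

theorem IsEigensystem.inner_one (H : P.IsEigensystem lam h) (k : ℕ+) (i : Fin 2) :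
    ⟪P.one, h k i⟫_ℝ = 0 := by
  obtain ⟨hd, hT⟩ := H.eigen k i
  exact inner_eq_zero_of_ne (u := ⟨P.one, one_mem_domain⟩) (lam := 0) (by rw [T_one, zero_smul]) hT
    (P.indexSet_pos (H.mem_indexSet k i)).ne

theorem IsEigensystem.orthonormal (H : P.IsEigensystem lam h) :
    Orthonormal ℝ (P.basisFamily h) := by
  constructor
  · rintro (_ | ⟨k, i⟩)
    · change ‖‖P.one‖⁻¹ • P.one‖ = 1
      rw [norm_smul, norm_inv, norm_norm, inv_mul_cancel₀ norm_one_pos.ne']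
    · exact H.norm_eq_one k i
  · rintro (_ | ⟨k, i⟩) (_ | ⟨k', i'⟩) hne
    · exact absurd rfl hne
    · change ⟪‖P.one‖⁻¹ • P.one, h k' i'⟫_ℝ = 0
      rw [inner_smul_left, H.inner_one, mul_zero]
    · change ⟪h k i, ‖P.one‖⁻¹ • P.one⟫_ℝ = 0
      rw [inner_smul_right, real_inner_comm, H.inner_one, mul_zero]
    · exact H.inner_eq_zero fun he => hne (congrArg some he)

/-- Every periodic eigenfunction with positive eigenvalue is a linear combination of the two
members of one pair of the eigensystem. -/
theorem IsEigensystem.exists_eq_linear_combination (H : P.IsEigensystem lam h) {mu : ℝ}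
    (hmu : 0 < mu) {f : P.C0} (hf : P.IsSolution mu f) :
    ∃ (k : ℕ+) (c₀ c₁ : ℝ), f = c₀ • h k 0 + c₁ • h k 1 := by
  by_cases hf0 : f = 0
  · exact ⟨1, 0, 0, by simp [hf0]⟩
  obtain ⟨k, hk⟩ := hf.isLeast_or_isGreatest hmu f.periodic (C0.coe_ne_zero hf0)
  obtain ⟨i, hi⟩ : ∃ i, mu = lam k i := by
    rcases hk with hk | hk
    · exact ⟨0, hk.unique (H.isLeast k)⟩
    · exact ⟨1, hk.unique (H.isGreatest k)⟩
  have hmem : mu ∈ P.indexSet k := hk.elim (·.1) (·.1)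
  refine ⟨k, ?_⟩
  by_cases hl : lam k 0 = lam k 1
  · have hall : ∀ j, lam k j = mu := by
      intro j
      rw [hi]
      fin_cases i <;> fin_cases j <;> simp [hl]
    have h0 : P.IsSolution mu (h k 0) := hall 0 ▸ H.isSolution k 0
    have h1 : P.IsSolution mu (h k 1) := hall 1 ▸ H.isSolution k 1
    by_cases hW : h k 0 0 * P.flux (h k 1) 0 - h k 1 0 * P.flux (h k 0) 0 = 0
    · obtain ⟨c, hc⟩ := h0.exists_eq_smul_of_wronskian_eq_zero h1
        (C0.coe_ne_zero (H.ne_zero k 1)) hW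
      have hc' : h k 0 = c • h k 1 := Subtype.ext hc
      have horth := H.double k hl
      rw [hc', inner_smul_left, real_inner_self_eq_norm_sq, H.norm_eq_one] at horth
      have : c = 0 := by simpa using horth
      rw [this, zero_smul] at hc'
      exact absurd hc' (H.ne_zero k 0)
    · obtain ⟨c₀, c₁, hc⟩ := h0.exists_eq_of_wronskian_ne_zero h1 hf hW
      exact ⟨c₀, c₁, Subtype.ext hc⟩
  · have hs : P.IsSolution mu (h k i) := hi ▸ H.isSolution k i
    by_cases hW : f 0 * P.flux (h k i) 0 - h k i 0 * P.flux f 0 = 0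
    · obtain ⟨c, hc⟩ := hf.exists_eq_smul_of_wronskian_eq_zero hs
        (C0.coe_ne_zero (H.ne_zero k i)) hW
      have hc' : f = c • h k i := Subtype.ext hc
      fin_cases i
      · exact ⟨c, 0, by rw [hc', zero_smul, add_zero]; rfl⟩
      · exact ⟨0, c, by rw [hc', zero_smul, zero_add]; rfl⟩
    -- Two independent periodic solutions would collapse the index set to one point, contrary to
    -- `lam k 0 ≠ lam k 1`.
    · obtain ⟨hle, hge⟩ := hf.isLeast_and_isGreatest hmem hs f.periodic (h k i).periodic hW
      exact absurd (((H.isLeast k).unique hle).trans (hge.unique (H.isGreatest k))) hl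

open UniformSpace in
theorem IsEigensystem.eq_zero_of_forall_inner_eq_zero (H : P.IsEigensystem lam h)
    {v : Completion P.C0}
    (hv : ∀ j, ⟪((P.basisFamily h j : P.C0) : Completion P.C0), v⟫_ℝ = 0) : v = 0 := by
  have hvk : ∀ k i, ⟪((h k i : P.C0) : Completion P.C0), v⟫_ℝ = 0 := fun k i => hv (some (k, i))
  have hv1 : ⟪((P.one : P.C0) : Completion P.C0), v⟫_ℝ = 0 := by
    have := hv none
    change ⟪((‖P.one‖⁻¹ • P.one : P.C0) : Completion P.C0), v⟫_ℝ = 0 at this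
    rw [Completion.coe_smul, inner_smul_left] at this
    exact (mul_eq_zero.1 this).resolve_left (by simpa using norm_one_pos.ne')
  have hgreen : ∀ f : P.C0, ⟪((P.green f : P.C0) : Completion P.C0), v⟫_ℝ = 0 := by
    refine ContinuousLinearMap.inner_range_eq_zero isCompactOperator_green green_symm ?_
    intro μ hμ f hf
    by_cases hf0 : f = 0
    · rw [hf0, Completion.coe_zero, inner_zero_left]
    have hf1 : f = μ⁻¹ • P.green f := by rw [hf, inv_smul_smul₀ hμ]
    have hfL : f ∈ P.L0 := by
      rw [hf1]
      exact P.L0.smul_mem _ (green_mem_L0 f)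
    have hfd : f ∈ P.T.domain := by
      rw [hf1]
      exact P.T.domain.smul_mem _ (green_mem_domain f)
    have hT : P.T ⟨f, hfd⟩ = μ⁻¹ • f := by
      have he : (⟨f, hfd⟩ : P.T.domain) = μ⁻¹ • ⟨P.green f, green_mem_domain f⟩ := Subtype.ext hf1
      rw [he, LinearPMap.map_smul, T_green, proj_eq_self hfL]
    -- The form of `T` is nonnegative and `μ⁻¹ ≠ 0`, so the classification of positive periodic
    -- eigenvalues applies to `f`.
    have hpos : 0 < μ⁻¹ := by
      have h1 := inner_T_self_nonneg (⟨f, hfd⟩ : P.T.domain)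
      rw [hT, inner_smul_right, real_inner_self_eq_norm_sq] at h1
      have h2 : 0 < ‖f‖ ^ 2 := pow_pos (norm_pos_iff.2 hf0) 2
      exact lt_of_le_of_ne (nonneg_of_mul_nonneg_left h1 h2) (inv_ne_zero hμ).symm
    obtain ⟨k, c₀, c₁, hc⟩ := H.exists_eq_linear_combination (f := f) hpos
      (T_eq_smul_iff (h := ⟨f, hfd⟩).1 hT)
    rw [hc, Completion.coe_add, Completion.coe_smul, Completion.coe_smul, inner_add_left,
      inner_smul_left, inner_smul_left, hvk, hvk, mul_zero, mul_zero, add_zero]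
  -- An element of the domain is a constant plus an element of `L₀`, and the latter is `P.green` of
  -- its image under `T`.
  have hdom : ∀ f ∈ P.T.domain, ⟪((f : P.C0) : Completion P.C0), v⟫_ℝ = 0 := by
    intro f hf
    have hp : P.proj f ∈ P.T.domain :=
      P.T.domain.sub_mem hf (P.T.domain.smul_mem _ one_mem_domain)
    have h1 := green_T ⟨P.proj f, hp⟩ (P.proj_mem f)
    have h2 : f = P.proj f + (⟪P.one, f⟫_ℝ / ‖P.one‖ ^ 2) • P.one := by
      rw [proj_apply, sub_add_cancel]
    have h3 := hgreen (P.T ⟨P.proj f, hp⟩)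
    rw [h1] at h3
    rw [h2, Completion.coe_add, Completion.coe_smul, inner_add_left, inner_smul_left, hv1,
      mul_zero, add_zero]
    exact h3
  have hdense : Dense (((↑) : P.C0 → Completion P.C0) '' (P.T.domain : Set P.C0)) :=
    Completion.denseRange_coe.dense_image (Completion.continuous_coe _) dense_domain
  have hclosed : IsClosed {w : Completion P.C0 | ⟪w, v⟫_ℝ = 0} :=
    isClosed_eq (continuous_id.inner continuous_const) continuous_const
  have huniv : v ∈ {w : Completion P.C0 | ⟪w, v⟫_ℝ = 0} :=
    hclosed.closure_subset_iff.2 (by rintro - ⟨f, hf, rfl⟩; exact hdom f hf) (hdense v)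
  exact inner_self_eq_zero.1 huniv

end

end NormedPlane

theorem mainTheorem6 (P : NormedPlane) :
    -- `T` is self-adjoint: densely defined, symmetric, and equal to its adjoint in `C⁰(S¹)`
    (Dense (P.T.domain : Set P.C0) ∧
      (∀ h₁ h₂ : P.T.domain, ⟪(h₁ : P.C0), P.T h₂⟫_ℝ = ⟪P.T h₁, (h₂ : P.C0)⟫_ℝ) ∧
      (∀ g f : P.C0, (∀ h : P.T.domain, ⟪g, P.T h⟫_ℝ = ⟪f, (h : P.C0)⟫_ℝ) →
        ∃ hg : g ∈ P.T.domain, P.T ⟨g, hg⟩ = f)) ∧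
    -- `T` restricted to `L₀` has an inverse `S : L₀ → L₀`, and `S` is compact
    (∃ S : P.L0 →L[ℝ] P.L0, IsCompactOperator S ∧
      (∀ f : P.L0, ∃ hd : (S f : P.C0) ∈ P.T.domain, P.T ⟨S f, hd⟩ = f) ∧
      (∀ g : P.T.domain, (g : P.C0) ∈ P.L0 →
        ∃ hT : P.T g ∈ P.L0, (S ⟨P.T g, hT⟩ : P.C0) = g)) ∧
    -- the functions `h_k^i` exist, and with the constants they form an orthonormal basis
    (∃ lam h, P.IsEigensystem lam h) ∧
    (∀ lam h, P.IsEigensystem lam h →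
      Orthonormal ℝ (P.basisFamily h) ∧
      ∀ f : P.C0, HasSum (fun j => ⟪P.basisFamily h j, f⟫_ℝ • P.basisFamily h j) f) := by
  refine ⟨⟨NormedPlane.dense_domain, NormedPlane.inner_T_symm,
    fun _ _ => NormedPlane.exists_T_eq_of_forall_inner_eq⟩, ⟨P.greenL0, NormedPlane.isCompactOperator_greenL0,
      fun f => ⟨NormedPlane.green_mem_domain (f : P.C0), ?_⟩, fun g hg => ⟨NormedPlane.T_mem_L0 g, ?_⟩⟩,
    P.exists_isEigensystem, fun lam h H => ⟨H.orthonormal,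
      H.orthonormal.hasSum_of_forall_completion fun _ => H.eq_zero_of_forall_inner_eq_zero⟩⟩
  · exact (NormedPlane.T_green _).trans (NormedPlane.proj_eq_self f.2)
  · exact NormedPlane.green_T g hg
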